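/- Let $\Omega_{\mathbf x}\subset\mathbb R^3$ be open and bounded, $t_0<T$, $\Omega=\Omega_{\mathbf x}\times(t_0,T)$ with coordinates $(x,y,z,t)$, and $\Gamma_{\mathbf x}=\partial\Omega_{\mathbf x}\times(t_0,T)$, $\Gamma_{t_0}=\Omega_{\mathbf x}\times\{t_0\}$, $\Gamma_T=\Omega_{\mathbf x}\times\{T\}$. Let $\varepsilon>0$ be a constant, and let $\alpha:\Omega\to\mathbb R$ and $\boldsymbol\beta:\Omega\to\mathbb R^3$ be measurable and bounded with $\alpha\ge\alpha_0>0$. Let $*$ be the Euclidean Hodge star in four dimensions (orientation $dx\wedge dy\wedge dz\wedge dt$), and let $*_\alpha$ be the scaled star: on a basis form $\omega$, $*_\alpha\omega=\varepsilon*\omega$ if $\omega$ involves $dt$, and $*_\alpha\omega=\alpha*\omega$ otherwise. Put $$\mathbf b=\alpha^{-1}(\beta_1dx+\beta_2dy+\beta_3dz)-\varepsilon^{-1}dt,\quad \mathrm J_k u=d_ku+\mathbf b\wedge u,\quad \delta_{1\alpha}=-{*}\,d\,{*_\alpha},\quad \delta_{\alpha1}=-{*_\alpha}\,d\,{*}.$$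 Let $H\Lambda^k_D(\Omega)$ be the space of $k$-forms $v\in L^2$ with $d_kv\in L^2$, with trace in $L^2(\Gamma_T)$, and with $\mathbf n\wedge v=0$ on $\Gamma_{\mathbf x}\cup\Gamma_{t_0}$. The boundary condition and the trace are understood in the usual sense of closure: $v$ is a limit of smooth $k$-forms that vanish near $\Gamma_{\mathbf x}\cup\Gamma_{t_0}$, in the norm $(\|d_kv\|^2_{L^2(\Omega)}+\|v\|^2_{L^2(\Omega)}+\|v\|^2_{L^2(\Gamma_T)})^{1/2}$, where the trace on $\Gamma_T$ is the tangential one (the coefficients without $dt$). Let $$(u,v)_\Omega=\int_\Omega u\wedge *v,\qquad \mathcal B(u,v)=(-1)^{(k+1)(4-(k+1))}(*{*_\alpha}\mathrm J_ku,d_kv)_\Omega+\langle u,v\rangle_{\Gamma_T},$$ where $\langle u,v\rangle_{\Gamma_T}$ is the $L^2(\Omega_{\mathbf x})$ inner product of the tangential traces on $\Gamma_T$. Let $0\le k\le4$, and let $f_k\in L^2\Lambda^k(\Omega)$ and $u_k$ be $k$-forms on $\Omega$ whose coefficients on all basis forms that involve $dt$ are zero. Then the following are equivalent. (1) $u_k\in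 H\Lambda^k_D(\Omega)$ (so that $u_k$ satisfies $\mathbf n_{\mathbf x}\wedge u_k=0$ on $\Gamma_{\mathbf x}$ and the initial condition $\mathbf n_{t_0}\wedge u_k=0$ on $\Gamma_{t_0}$); $d{*}u_k\in L^2$ and $$(\delta^k_{1\alpha}\mathrm J_k+d_{k-1}\delta^{k-1}_{\alpha1})u_k=f_k\quad\text{in }\Omega$$ in the sense of distributions; and $\iota_{\mathbf n_T}(*{*_\alpha}d_ku_k)=0$ on $\Gamma_T$, in the sense that $\iota_{\mathbf n_T}(*{*_\alpha}d_ku_k)(\cdot,t)\to0$ as $t\to T^-$ in the sense of distributions on $\Omega_{\mathbf x}$. Here $\iota_{\mathbf n_T}$ sends $w\,\omega\wedge dt$ to $w\,\omega$ and forms without $dt$ to $0$. (2) $u_k\in H\Lambda^k_D(\Omega)$ and $\mathcal B(u_k,v_k)=(f_k,v_k)_\Omega$ for all $v_k\in H\Lambda^k_D(\Omega)$. -/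

import Mathlib

open MeasureTheory Filter Topology
open scoped ContDiff

noncomputable section

namespace SpaceTime

/-- Space-time `ℝ³ × ℝ`, with points `(x, t)`. -/
abbrev Pt : Type := (Fin 3 → ℝ) × ℝ

/-- The coordinate directions `x, y, z, t` (in this order; the last index is time). -/
def unitVec : Fin 4 → Pt :=
  Fin.snoc (α := fun _ => Pt) (fun j : Fin 3 => ((Pi.single j 1 : Fin 3 → ℝ), (0 : ℝ)))
    ((0 : Fin 3 → ℝ), (1 : ℝ))

/-- The partial derivative in the direction of the `i`-th coordinate. -/
def pderiv (i : Fin 4) (φ : Pt → ℝ) (y : Pt) : ℝ := fderiv ℝ φ y (unitVec i)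

/-! ### Exterior algebra in four dimensions

An exterior form `∑_I w_I dx^I` is its family of coefficients, where `I` runs over the subsets of
the four coordinates and `dx^I` is the wedge product of the `dx^i`, `i ∈ I`, in increasing order.
The coefficients may lie in any additive group (numbers, or distributions). -/

abbrev Form (M : Type*) : Type _ := Finset (Fin 4) → M

/-- The sign `s` with `dx^A ∧ dx^B = s dx^(A ∪ B)` for disjoint `A` and `B`. -/
def sgn (A B : Finset (Fin 4)) : ℤ :=
  (-1) ^ ((A ×ˢ B).filter (fun p => p.2 < p.1)).card

/-- `w` has degree `k`. -/
def IsForm (k : ℕ) (w : Form ℝ) : Prop := ∀ I : Finset (Fin 4), I.card ≠ k → w I = 0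

/-- No coefficient of `w` involves `dt`. -/
def NoDt (w : Form ℝ) : Prop := ∀ I : Finset (Fin 4), Fin.last 3 ∈ I → w I = 0

/-- The wedge product. -/
def wedge (w η : Form ℝ) : Form ℝ :=
  fun J => ∑ A ∈ J.powerset, (sgn A (J \ A) : ℝ) * w A * η (J \ A)

/-- The 1-form `∑ i, c i dx^i`. -/
def oneForm (c : Fin 4 → ℝ) : Form ℝ := fun I => ∑ i, if I = {i} then c i else 0

/-- The Euclidean Hodge star, `* dx^I = s dx^(Iᶜ)` where `dx^I ∧ s dx^(Iᶜ) = dx ∧ dy ∧ dz ∧ dt`. -/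
def hodge {M : Type*} [AddCommGroup M] (w : Form M) : Form M := fun J => sgn Jᶜ J • w Jᶜ

/-- The scaled Hodge star `*_α`: `* dx^I` times `ε` if `dx^I` involves `dt`, and times `a`
otherwise. -/
def hodgeScaled (a ε : ℝ) (w : Form ℝ) : Form ℝ :=
  hodge (fun I => (if Fin.last 3 ∈ I then ε else a) * w I)

/-- The contraction `ι_{n_T}`: `w dx^I ∧ dt ↦ w dx^I`, and forms without `dt` are sent to `0`. -/
def contractT (w : Form ℝ) : Form ℝ :=
  fun I => if Fin.last 3 ∈ I then 0 else w (insert (Fin.last 3) I)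

/-- The tangential part of a form at a point of a slice `{t = const}` (the part without `dt`). -/
def tangential (w : Form ℝ) : Form ℝ := fun I => if Fin.last 3 ∈ I then 0 else w I

/-! ### Exterior derivatives -/

/-- The exterior derivative of a smooth form. -/
def extD (v : Pt → Form ℝ) (y : Pt) : Form ℝ :=
  fun J => ∑ i ∈ J, (sgn {i} (J.erase i) : ℝ) * pderiv i (fun z => v z (J.erase i)) y

/-- Test functions on an open set. -/
def IsTest {E : Type*} [NormedAddCommGroup E] [NormedSpace ℝ E] (U : Set E) (φ : E → ℝ) : Prop :=
  ContDiff ℝ ∞ φ ∧ HasCompactSupport φ ∧ tsupport φ ⊆ U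

/-- The distributional exterior derivative of a form with locally integrable coefficients: a form
whose coefficients are distributions on `U` (functionals of a test function). -/
def distD (U : Set Pt) (w : Pt → Form ℝ) : Form ((Pt → ℝ) → ℝ) :=
  fun J φ => -∫ y in U, ∑ i ∈ J, (sgn {i} (J.erase i) : ℝ) * w y (J.erase i) * pderiv i φ y

/-- A form whose coefficients are locally integrable functions, as a form of distributions. -/
def toDist (U : Set Pt) (w : Pt → Form ℝ) : Form ((Pt → ℝ) → ℝ) :=
  fun J φ => ∫ y in U, w y J * φ y

/-- The function-valued form `E` is the weak exterior derivative of `w` in `U`. -/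
def IsWeakExtD (U : Set Pt) (w E : Pt → Form ℝ) : Prop :=
  ∀ J : Finset (Fin 4), ∀ φ : Pt → ℝ, IsTest U φ → toDist U E J φ = distD U w J φ

/-- Square-integrable coefficients. -/
def L2Form {X : Type*} [MeasureSpace X] (U : Set X) (w : X → Form ℝ) : Prop :=
  ∀ I : Finset (Fin 4), MemLp (fun y => w y I) 2 (volume.restrict U)

/-! ### The space-time cylinder and the space of forms with vanishing trace on `Γ_D` -/

/-- The space-time domain `Ω = Ω_x × (t₀, T)`. -/
def cylinder (Ωx : Set (Fin 3 → ℝ)) (t₀ T : ℝ) : Set Pt := Ωx ×ˢ Set.Ioo t₀ T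

/-- Smooth `k`-forms (up to and beyond `t = T`) that vanish near `Γ_x` and near `Γ_{t₀}`. -/
structure IsSmoothDirichlet (k : ℕ) (Ωx : Set (Fin 3 → ℝ)) (t₀ : ℝ) (v : Pt → Form ℝ) : Prop where
  isForm : ∀ y, IsForm k (v y)
  smooth : ∀ I, ContDiff ℝ ∞ (fun y => v y I)
  compact : HasCompactSupport v
  support : tsupport v ⊆ Ωx ×ˢ Set.Ioi t₀

/-- Convergence in `L²` of all coefficients. -/
def TendstoL2 {X : Type*} [MeasureSpace X] (U : Set X) (vn : ℕ → X → Form ℝ) (v : X → Form ℝ) :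
    Prop :=
  ∀ I : Finset (Fin 4),
    Tendsto (fun n => eLpNorm (fun y => vn n y I - v y I) 2 (volume.restrict U)) atTop (𝓝 0)

/-- `v ∈ HΛ^k_D(Ω)`, with exterior derivative `dv ∈ L²` and (tangential) trace `g ∈ L²` on `Γ_T`.

The homogeneous conditions `n_x ∧ v = 0` on `Γ_x` and `n_{t₀} ∧ v = 0` on `Γ_{t₀}` are taken in the
usual Sobolev sense: `v` is a limit of smooth forms that vanish near `Γ_D = Γ_x ∪ Γ_{t₀}`, in the
norm `(‖d v‖²_{L²(Ω)} + ‖v‖²_{L²(Ω)} + ‖v‖²_{L²(Γ_T)})^{1/2}`, whose last term measures the trace on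
`Γ_T`; the limits of the exterior derivatives and of the traces are `dv` and `g`. -/
structure MemHD (k : ℕ) (Ωx : Set (Fin 3 → ℝ)) (t₀ T : ℝ)
    (v dv : Pt → Form ℝ) (g : (Fin 3 → ℝ) → Form ℝ) : Prop where
  memL2 : L2Form (cylinder Ωx t₀ T) v
  deriv_memL2 : L2Form (cylinder Ωx t₀ T) dv
  trace_memL2 : L2Form Ωx g
  approx : ∃ vn : ℕ → Pt → Form ℝ, (∀ n, IsSmoothDirichlet k Ωx t₀ (vn n)) ∧
    TendstoL2 (cylinder Ωx t₀ T) vn v ∧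
    TendstoL2 (cylinder Ωx t₀ T) (fun n => extD (vn n)) dv ∧
    TendstoL2 Ωx (fun n x => tangential (vn n (x, T))) g

/-- The `L²` inner product `(u, v)_U = ∫_U u ∧ * v`, the integral of the coefficient of
`dx ∧ dy ∧ dz ∧ dt`, with respect to Lebesgue measure. It serves for `U = Ω` and, applied to traces,
for `U = Γ_T`, which is identified with `Ω_x`. -/
def innerL2 {X : Type*} [MeasureSpace X] (U : Set X) (u v : X → Form ℝ) : ℝ :=
  ∫ y in U, wedge (u y) (hodge (v y)) Finset.univ

/-! ### The unified equation and the variational problem -/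

/-- The convection 1-form `b = α⁻¹ β₁ dx + α⁻¹ β₂ dy + α⁻¹ β₃ dz - ε⁻¹ dt`. -/
def convForm (α : Pt → ℝ) (β : Pt → Fin 3 → ℝ) (ε : ℝ) (y : Pt) : Form ℝ :=
  oneForm (Fin.snoc (α := fun _ => ℝ) (fun j : Fin 3 => (α y)⁻¹ * β y j) (-ε⁻¹))

/-- The flux `J u = d u + b ∧ u`. -/
def flux (α : Pt → ℝ) (β : Pt → Fin 3 → ℝ) (ε : ℝ) (u du : Pt → Form ℝ) (y : Pt) : Form ℝ :=
  du y + wedge (convForm α β ε y) (u y)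

/-- The distribution `δ_{1α} η = - * d *_α η`. -/
def codiffOneAlpha (U : Set Pt) (α : Pt → ℝ) (ε : ℝ) (η : Pt → Form ℝ) : Form ((Pt → ℝ) → ℝ) :=
  -hodge (distD U (fun y => hodgeScaled (α y) ε (η y)))

/-- `s = δ_{α1} u = - *_α d * u`, where `d * u` is a square-integrable weak derivative. -/
def IsCodiffAlphaOne (U : Set Pt) (α : Pt → ℝ) (ε : ℝ) (u s : Pt → Form ℝ) : Prop :=
  ∃ E : Pt → Form ℝ, L2Form U E ∧ IsWeakExtD U (fun y => hodge (u y)) E ∧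
    s = fun y => -hodgeScaled (α y) ε (E y)

/-- The unified equation `(δ_{1α} J + d δ_{α1}) u = f` in `U`, in the sense of distributions
(`du` is the exterior derivative of `u`). -/
def UnifiedEquation (U : Set Pt) (α : Pt → ℝ) (β : Pt → Fin 3 → ℝ) (ε : ℝ)
    (u du f : Pt → Form ℝ) : Prop :=
  ∃ s : Pt → Form ℝ, IsCodiffAlphaOne U α ε u s ∧
    ∀ I : Finset (Fin 4), ∀ φ : Pt → ℝ, IsTest U φ →
      (codiffOneAlpha U α ε (flux α β ε u du) + distD U s) I φ = toDist U f I φ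

/-- `ι_{n_T} η = 0` on `Γ_T`: the coefficients of `ι_{n_T} η(·, t)` tend to `0` as `t → T⁻`, in the
sense of distributions on `Ω_x`. As `η` is defined almost everywhere only, the function of `t` is
understood up to a null set. -/
def NormalTraceZero (Ωx : Set (Fin 3 → ℝ)) (t₀ T : ℝ) (η : Pt → Form ℝ) : Prop :=
  ∀ I : Finset (Fin 4), ∀ φ : (Fin 3 → ℝ) → ℝ, IsTest Ωx φ →
    ∃ h : ℝ → ℝ,
      (∀ᵐ t ∂(volume.restrict (Set.Ioo t₀ T)),
        h t = ∫ x in Ωx, contractT (η (x, t)) I * φ x) ∧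
      Tendsto h (𝓝[<] T) (𝓝 0)

/-- `u` solves the unified equation with the three boundary conditions (zero initial datum): the
conditions on `Γ_x` and `Γ_{t₀}` are contained in `MemHD`, and `ι_{n_T}(* *_α d u) = 0` on `Γ_T`. -/
def IsUnifiedSolution (k : ℕ) (Ωx : Set (Fin 3 → ℝ)) (t₀ T : ℝ) (α : Pt → ℝ)
    (β : Pt → Fin 3 → ℝ) (ε : ℝ) (f u : Pt → Form ℝ) : Prop :=
  ∃ (du : Pt → Form ℝ) (g : (Fin 3 → ℝ) → Form ℝ),
    MemHD k Ωx t₀ T u du g ∧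
    UnifiedEquation (cylinder Ωx t₀ T) α β ε u du f ∧
    NormalTraceZero Ωx t₀ T (fun y => hodge (hodgeScaled (α y) ε (du y)))

/-- The bilinear form
`𝓑(u, v) = (-1)^((k+1)(4-(k+1))) (* *_α J u, d v)_Ω + ⟨u, v⟩_{Γ_T}`,
for `u` with exterior derivative `du` and terminal trace `g`, and `v` with exterior derivative `dv`
and terminal trace `h`. -/
def bilin (k : ℕ) (Ωx : Set (Fin 3 → ℝ)) (t₀ T : ℝ) (α : Pt → ℝ) (β : Pt → Fin 3 → ℝ) (ε : ℝ)
    (u du : Pt → Form ℝ) (g : (Fin 3 → ℝ) → Form ℝ)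
    (dv : Pt → Form ℝ) (h : (Fin 3 → ℝ) → Form ℝ) : ℝ :=
  (-1 : ℝ) ^ (((k : ℤ) + 1) * (4 - ((k : ℤ) + 1))) *
      innerL2 (cylinder Ωx t₀ T) (fun y => hodge (hodgeScaled (α y) ε (flux α β ε u du y))) dv
    + innerL2 Ωx g h

/-- `u` solves the variational problem: `u ∈ HΛ^k_D(Ω)` and `𝓑(u, v) = (f, v)_Ω` for all
`v ∈ HΛ^k_D(Ω)`. -/
def IsVariationalSolution (k : ℕ) (Ωx : Set (Fin 3 → ℝ)) (t₀ T : ℝ) (α : Pt → ℝ)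
    (β : Pt → Fin 3 → ℝ) (ε : ℝ) (f u : Pt → Form ℝ) : Prop :=
  ∃ (du : Pt → Form ℝ) (g : (Fin 3 → ℝ) → Form ℝ),
    MemHD k Ωx t₀ T u du g ∧
    ∀ (v dv : Pt → Form ℝ) (h : (Fin 3 → ℝ) → Form ℝ), MemHD k Ωx t₀ T v dv h →
      bilin k Ωx t₀ T α β ε u du g dv h = innerL2 (cylinder Ωx t₀ T) f v

end SpaceTime

end

open MeasureTheory Filter Topology
open scoped ContDiff

noncomputable section

namespace SpaceTime

/-! ### Signs and exterior algebra -/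

/-! Write `S` for the flux multiplied by `ε` or `α` (`scaledFlux`). Both problems are compared with
one identity, `WeakEquation`: each coefficient of the adjoint of `d` applied to `S`, plus the trace
of `u` at `T`, equals the coefficient of `f`, against test functions that vanish near `Γ_x` and
`Γ_{t₀}` but are free at `T`. The sign in `bilin` cancels `**`, and density of smooth forms makes
this identity the variational problem (`forall_bilin_eq_iff_weakEquation`).

Coefficients with `dt`. Let `D` be the weak codifferential of `u`, that is, `d * u` up to signs. As
`u` has no `dt`, these coefficients of the identity read `ε D(∂_t φ) + D(φ) = 0` up to a sign, i.e.
`ε ∂_t D = D` (`weakCodiff_time`). In the unified equation the term `d δ_{α1} u` removes exactly the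
`ε` part, which leaves `D = 0` (`UnifiedEquation.weakCodiff_eq`). In the variational problem that
term is absent; but these coefficients contain no time derivative of the test function, so it need
not vanish at `t₀` (`weakCodiff_eq_zero_of_cylinder`). Thus `D` has zero initial value, and the ODE
forces `D = 0` (`weakCodiff_eq_zero_of_evolution`). Either way `δ_{α1} u = 0`, and the two equations
agree inside `Ω`.

Coefficients without `dt`. Green's formula in time absorbs the trace term and the convection by
`-ε⁻¹ dt`; the only boundary contribution left at `T` is `ε` times the `dt` part of `d u`. Testing
with functions free at `T` shows that its slices tend to zero (`exists_slice_tendsto_zero`).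
Conversely, a time cutoff near `T` reduces free test functions to those supported in `Ω`, and the
derivative of the cutoff meets only this vanishing quantity
(`tendsto_integral_mul_cutoffDeriv_of_slice`). -/

theorem sgn_mul_self (A B : Finset (Fin 4)) : sgn A B * sgn A B = 1 := by
  rw [sgn, ← mul_pow]
  simp

theorem sgn_cast_mul_self (A B : Finset (Fin 4)) : (sgn A B : ℝ) * sgn A B = 1 := by
  exact_mod_cast sgn_mul_self A B

theorem sgn_last : ∀ A : Finset (Fin 4), Fin.last 3 ∉ A → sgn {Fin.last 3} A = (-1) ^ A.card := by
  decide +kernel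

theorem sgn_singleton_insert_last : ∀ (i : Fin 4) (K : Finset (Fin 4)), i ≠ Fin.last 3 →
    sgn {i} (insert (Fin.last 3) K) = sgn {i} K := by
  decide +kernel

/-- The sign identity that makes `* d *` the adjoint of `d` coefficient by coefficient; a finite
check over all subsets of the four coordinates. -/
theorem sgn_singleton_compl : ∀ (I : Finset (Fin 4)) (i : Fin 4), i ∉ I →
    sgn Iᶜ I * (sgn {i} (Iᶜ.erase i) * sgn (insert i I) (Iᶜ.erase i)) = sgn {i} I := by
  decide +kernel

theorem sgn_compl_mul_sgn : ∀ J : Finset (Fin 4),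
    sgn Jᶜ J * sgn J Jᶜ = (-1) ^ (J.card * (4 - J.card)) := by
  decide +kernel

/-- The product of the two signs is the scalar by which `**` acts in degree `k + 1`, so the
prefactor of `bilin` is there to cancel it. -/
theorem neg_one_zpow_mul_sgn {k : ℕ} {J : Finset (Fin 4)} (hJ : J.card = k + 1) :
    (-1 : ℝ) ^ (((k : ℤ) + 1) * (4 - ((k : ℤ) + 1))) * ((sgn Jᶜ J : ℝ) * sgn J Jᶜ) = 1 := by
  have h4 : k + 1 ≤ 4 := hJ ▸ Finset.card_le_univ J
  have h := congrArg (Int.cast : ℤ → ℝ) (sgn_compl_mul_sgn J)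
  push_cast at h
  rw [h, hJ, show ((k : ℤ) + 1) * (4 - ((k : ℤ) + 1)) = (((k + 1) * (4 - (k + 1)) : ℕ) : ℤ) by
    rw [Nat.cast_mul, Nat.cast_sub h4]; push_cast; rfl, zpow_natCast, ← mul_pow]
  simp

theorem wedge_oneForm (c : Fin 4 → ℝ) (w : Form ℝ) (J : Finset (Fin 4)) :
    wedge (oneForm c) w J = ∑ i ∈ J, (sgn {i} (J.erase i) : ℝ) * c i * w (J.erase i) := by
  have h : ∀ A ∈ J.powerset, (sgn A (J \ A) : ℝ) * oneForm c A * w (J \ A) =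
      ∑ i, if A = {i} then (sgn {i} (J.erase i) : ℝ) * c i * w (J.erase i) else 0 := by
    intro A _
    rw [oneForm, Finset.mul_sum, Finset.sum_mul]
    refine Finset.sum_congr rfl fun i _ => ?_
    split_ifs with hA
    · subst hA
      rw [Finset.sdiff_singleton_eq_erase]
    · simp
  rw [wedge, Finset.sum_congr rfl h, Finset.sum_comm, ← Finset.sum_filter_add_sum_filter_not
    Finset.univ (· ∈ J)]
  rw [Finset.sum_eq_zero (s := Finset.univ.filter (· ∉ J)), add_zero]
  · refine Finset.sum_congr (by ext; simp) fun i hi => ?_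
    rw [Finset.sum_ite_eq']
    simp_all
  · intro i hi
    rw [Finset.sum_ite_eq']
    simp_all

theorem wedge_hodge_univ (w v : Form ℝ) :
    wedge w (hodge v) Finset.univ = ∑ A, w A * v A := by
  rw [wedge, Finset.powerset_univ]
  refine Finset.sum_congr rfl fun A _ => ?_
  have h := sgn_cast_mul_self A Aᶜ
  rw [hodge, ← Finset.compl_eq_univ_sdiff, compl_compl, zsmul_eq_mul]
  linear_combination w A * v A * h

/-- Pairs `(J, i)` with `i ∈ J` correspond to pairs `(I, i)` with `i ∉ I` through `I = J.erase i`.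
This transposes the sum that defines `d` into the one that defines its adjoint. -/
theorem sum_erase_eq_sum_insert {M : Type*} [AddCommMonoid M]
    (F : Finset (Fin 4) → Fin 4 → Finset (Fin 4) → M) :
    ∑ J, ∑ i ∈ J, F J i (J.erase i) = ∑ I, ∑ i ∈ Iᶜ, F (insert i I) i I := by
  rw [Finset.sum_sigma', Finset.sum_sigma']
  refine Finset.sum_bij' (fun p _ => ⟨p.1.erase p.2, p.2⟩) (fun p _ => ⟨insert p.2 p.1, p.2⟩)
    ?_ ?_ ?_ ?_ ?_
  · rintro ⟨J, i⟩ h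
    simp
  · rintro ⟨I, i⟩ h
    simp
  · rintro ⟨J, i⟩ h
    simp only [Finset.mem_sigma, Finset.mem_univ, true_and] at h
    simp [Finset.insert_erase h]
  · rintro ⟨I, i⟩ h
    simp only [Finset.mem_sigma, Finset.mem_univ, true_and, Finset.mem_compl] at h
    simp [Finset.erase_insert h]
  · rintro ⟨J, i⟩ h
    simp only [Finset.mem_sigma, Finset.mem_univ, true_and] at h
    simp [Finset.insert_erase h]

/-! ### Partial derivatives -/

theorem unitVec_last : unitVec (Fin.last 3) = ((0 : Fin 3 → ℝ), (1 : ℝ)) :=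
  Fin.snoc_last _ _

theorem unitVec_castSucc (j : Fin 3) : unitVec j.castSucc = (Pi.single j 1, (0 : ℝ)) :=
  Fin.snoc_castSucc _ _ _

theorem contDiff_pderiv {φ : Pt → ℝ} (hφ : ContDiff ℝ ∞ φ) (i : Fin 4) :
    ContDiff ℝ ∞ (pderiv i φ) :=
  (hφ.fderiv_right (m := ∞) (by simp)).clm_apply contDiff_const

theorem tsupport_pderiv_subset (φ : Pt → ℝ) (i : Fin 4) : tsupport (pderiv i φ) ⊆ tsupport φ := by
  refine (closure_mono fun y hy => ?_).trans (tsupport_fderiv_subset ℝ (f := φ))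
  refine (Function.mem_support.2 fun h : fderiv ℝ φ y = 0 => hy ?_)
  simp [pderiv, h]

theorem IsTest.pderiv {U : Set Pt} {φ : Pt → ℝ} (hφ : IsTest U φ) (i : Fin 4) :
    IsTest U (pderiv i φ) :=
  ⟨contDiff_pderiv hφ.1 i,
    hφ.2.1.of_isClosed_subset (isClosed_tsupport _) (tsupport_pderiv_subset φ i),
    (tsupport_pderiv_subset φ i).trans hφ.2.2⟩

theorem pderiv_mul {φ ψ : Pt → ℝ} (hφ : ContDiff ℝ ∞ φ) (hψ : ContDiff ℝ ∞ ψ) (i : Fin 4) (y : Pt) :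
    pderiv i (fun z => φ z * ψ z) y = φ y * pderiv i ψ y + pderiv i φ y * ψ y := by
  simp only [pderiv]
  rw [fderiv_fun_mul (hφ.differentiable (by simp) y) (hψ.differentiable (by simp) y)]
  simp [mul_comm]

theorem pderiv_comm {φ : Pt → ℝ} (hφ : ContDiff ℝ ∞ φ) (i j : Fin 4) :
    pderiv i (pderiv j φ) = pderiv j (pderiv i φ) := by
  have hd : Differentiable ℝ (fderiv ℝ φ) :=
    (hφ.fderiv_right (m := ∞) (by simp)).differentiable (by simp)
  have key : ∀ (a b : Fin 4) (y : Pt), pderiv a (pderiv b φ) y =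
      fderiv ℝ (fderiv ℝ φ) y (unitVec a) (unitVec b) := by
    intro a b y
    change fderiv ℝ (fun z => fderiv ℝ φ z (unitVec b)) y (unitVec a) = _
    rw [fderiv_clm_apply (hd y) (differentiableAt_const _)]
    simp
  ext y
  rw [key, key]
  exact (hφ.contDiffAt.isSymmSndFDerivAt (by simp [ENat.LEInfty.out])).eq _ _

theorem hasDerivAt_time {φ : Pt → ℝ} (hφ : ContDiff ℝ ∞ φ) (x : Fin 3 → ℝ) (t : ℝ) :
    HasDerivAt (fun s => φ (x, s)) (pderiv (Fin.last 3) φ (x, t)) t := by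
  have h := ((hφ.differentiable (by simp)) (x, t)).hasFDerivAt.comp_hasDerivAt t
    ((hasDerivAt_const t x).prodMk (hasDerivAt_id t))
  rwa [← unitVec_last] at h

theorem fderiv_slice {φ : Pt → ℝ} (hφ : ContDiff ℝ ∞ φ) (x : Fin 3 → ℝ) (t : ℝ) (j : Fin 3) :
    fderiv ℝ (fun z => φ (z, t)) x (Pi.single j 1) = pderiv j.castSucc φ (x, t) := by
  have h := HasFDerivAt.comp (f := fun z : Fin 3 → ℝ => (z, t)) x
    ((hφ.differentiable (by simp)) (x, t)).hasFDerivAt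
    ((hasFDerivAt_id x).prodMk (hasFDerivAt_const t x))
  rw [pderiv, unitVec_castSucc, show fderiv ℝ (fun z => φ (z, t)) x = _ from h.fderiv]
  simp

theorem pderiv_castSucc_comp_snd (θ : ℝ → ℝ) (hθ : ContDiff ℝ ∞ θ) {i : Fin 4}
    (hi : i ≠ Fin.last 3) (y : Pt) : pderiv i (fun z => θ z.2) y = 0 := by
  obtain ⟨j, rfl⟩ := Fin.exists_castSucc_eq.2 hi
  rw [← fderiv_slice (φ := fun z => θ z.2) (hθ.comp contDiff_snd) y.1 y.2]
  simp

theorem pderiv_last_comp_snd (θ : ℝ → ℝ) (hθ : ContDiff ℝ ∞ θ) (y : Pt) :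
    pderiv (Fin.last 3) (fun z => θ z.2) y = deriv θ y.2 :=
  (hasDerivAt_time (φ := fun z => θ z.2) (hθ.comp contDiff_snd) y.1 y.2).deriv.symm

theorem pderiv_last_comp_fst (χ : (Fin 3 → ℝ) → ℝ) (hχ : ContDiff ℝ ∞ χ) (y : Pt) :
    pderiv (Fin.last 3) (fun z => χ z.1) y = 0 := by
  rw [← (hasDerivAt_time (φ := fun z => χ z.1) (hχ.comp contDiff_fst) y.1 y.2).deriv]
  simp

/-! ### Integrals over the cylinder -/

theorem isBounded_cylinder {Ωx : Set (Fin 3 → ℝ)} (hb : Bornology.IsBounded Ωx) (t₀ T : ℝ) :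
    Bornology.IsBounded (cylinder Ωx t₀ T) :=
  hb.prod (Metric.isBounded_Ioo _ _)

theorem isOpen_cylinder {Ωx : Set (Fin 3 → ℝ)} (ho : IsOpen Ωx) (t₀ T : ℝ) :
    IsOpen (cylinder Ωx t₀ T) :=
  ho.prod isOpen_Ioo

theorem exists_bound_of_isBounded {X : Type*} [PseudoMetricSpace X] [ProperSpace X] {U : Set X}
    (hU : Bornology.IsBounded U) {ψ : X → ℝ} (hψ : Continuous ψ) :
    ∃ C, 0 ≤ C ∧ ∀ y ∈ U, |ψ y| ≤ C := by
  obtain ⟨C, hC⟩ := hU.isCompact_closure.exists_bound_of_continuousOn hψ.continuousOn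
  exact ⟨max C 0, le_max_right _ _, fun y hy => (hC y (subset_closure hy)).trans (le_max_left _ _)⟩

instance isFiniteMeasure_restrict_of_isBounded {X : Type*} [PseudoMetricSpace X] [ProperSpace X]
    [MeasureSpace X] [IsFiniteMeasureOnCompacts (volume : Measure X)] {U : Set X}
    [hU : Fact (Bornology.IsBounded U)] : IsFiniteMeasure (volume.restrict U) :=
  ⟨by simpa using hU.out.measure_lt_top⟩

theorem memLp_restrict_of_continuous {X : Type*} [PseudoMetricSpace X] [ProperSpace X]
    [MeasureSpace X] [BorelSpace X] [IsFiniteMeasureOnCompacts (volume : Measure X)] {U : Set X}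
    (hU : Bornology.IsBounded U) (hm : MeasurableSet U) {ψ : X → ℝ} (hψ : Continuous ψ) :
    MemLp ψ 2 (volume.restrict U) := by
  have := Fact.mk hU
  obtain ⟨C, -, hC⟩ := exists_bound_of_isBounded hU hψ
  exact MemLp.of_bound hψ.aestronglyMeasurable C ((ae_restrict_iff' hm).2 (ae_of_all _ hC))

theorem tendsto_integral_mul_of_tendsto_eLpNorm {X : Type*} [MeasurableSpace X] {μ : Measure X}
    {un : ℕ → X → ℝ} {u w : X → ℝ} (hun : ∀ n, MemLp (un n) 2 μ) (hu : MemLp u 2 μ)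
    (hw : MemLp w 2 μ) (h : Tendsto (fun n => eLpNorm (fun y => un n y - u y) 2 μ) atTop (𝓝 0)) :
    Tendsto (fun n => ∫ y, un n y * w y ∂μ) atTop (𝓝 (∫ y, u y * w y ∂μ)) := by
  refine tendsto_integral_of_L1' _ (hu.integrable_mul hw).1
    (Eventually.of_forall fun n => (hun n).integrable_mul hw) ?_
  have h2 : Tendsto (fun n => eLpNorm (fun y => un n y - u y) 2 μ * eLpNorm w 2 μ) atTop (𝓝 0) := by
    have := ENNReal.Tendsto.mul_const h (Or.inr hw.2.ne)
    rwa [zero_mul] at this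
  refine tendsto_of_tendsto_of_tendsto_of_le_of_le tendsto_const_nhds h2 (fun n => zero_le)
    fun n => ?_
  have := eLpNorm_smul_le_mul_eLpNorm (p := 2) (q := 2) (r := 1) hw.1 ((hun n).sub hu).1
  rwa [show (un n - u) • w = (fun y => un n y * w y) - fun y => u y * w y by
    ext y; simp [sub_mul]] at this

theorem volume_restrict_cylinder (Ωx : Set (Fin 3 → ℝ)) (t₀ T : ℝ) :
    (volume : Measure Pt).restrict (cylinder Ωx t₀ T) =
      ((volume : Measure (Fin 3 → ℝ)).restrict Ωx).prod (volume.restrict (Set.Ioo t₀ T)) := by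
  rw [cylinder, Measure.volume_eq_prod, Measure.prod_restrict]

theorem setIntegral_cylinder {Ωx : Set (Fin 3 → ℝ)} {t₀ T : ℝ} {F : Pt → ℝ}
    (hF : IntegrableOn F (cylinder Ωx t₀ T)) :
    ∫ y in cylinder Ωx t₀ T, F y = ∫ x in Ωx, ∫ t in Set.Ioo t₀ T, F (x, t) := by
  rw [IntegrableOn, volume_restrict_cylinder] at hF
  rw [volume_restrict_cylinder, integral_prod _ hF]

theorem setIntegral_cylinder_symm {Ωx : Set (Fin 3 → ℝ)} {t₀ T : ℝ} {F : Pt → ℝ}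
    (hF : IntegrableOn F (cylinder Ωx t₀ T)) :
    ∫ y in cylinder Ωx t₀ T, F y = ∫ t in Set.Ioo t₀ T, ∫ x in Ωx, F (x, t) := by
  rw [IntegrableOn, volume_restrict_cylinder] at hF
  rw [volume_restrict_cylinder, integral_prod_symm _ hF]

/-- On each time slice the function has compact support in `Ωx`, so the integral extends to the
whole space and no regularity of the boundary of `Ωx` is needed. -/
theorem integral_pderiv_castSucc {Ωx : Set (Fin 3 → ℝ)} {t₀ T : ℝ} {φ : Pt → ℝ}
    (hφ : IsTest (Ωx ×ˢ Set.Ioi t₀) φ) {i : Fin 4} (hi : i ≠ Fin.last 3) :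
    ∫ y in cylinder Ωx t₀ T, pderiv i φ y = 0 := by
  obtain ⟨j, rfl⟩ := Fin.exists_castSucc_eq.2 hi
  have hp := hφ.pderiv j.castSucc
  rw [setIntegral_cylinder_symm
    (hp.1.continuous.integrable_of_hasCompactSupport hp.2.1).integrableOn]
  refine integral_eq_zero_of_ae (ae_of_all _ fun t => ?_)
  have hcl : Topology.IsClosedEmbedding (fun x : Fin 3 → ℝ => ((x, t) : Pt)) :=
    ⟨Topology.IsEmbedding.of_leftInverse (Y := Fin 3 → ℝ) (X := Pt) (g := fun x => (x, t))
      (f := Prod.fst) (fun _ => rfl) continuous_fst (by fun_prop), by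
        have : Set.range (fun x : Fin 3 → ℝ => ((x, t) : Pt)) = Prod.snd ⁻¹' {t} := by
          ext ⟨a, b⟩; simp [eq_comm]
        rw [this]
        exact isClosed_singleton.preimage continuous_snd⟩
  have hc : HasCompactSupport (fun x => φ (x, t)) := hφ.2.1.comp_isClosedEmbedding hcl
  have hcp : HasCompactSupport (fun x => pderiv j.castSucc φ (x, t)) :=
    hp.2.1.comp_isClosedEmbedding hcl
  have hs : ∀ x ∉ Ωx, pderiv j.castSucc φ (x, t) = 0 := fun x hx =>
    image_eq_zero_of_notMem_tsupport fun h => hx (hp.2.2 h).1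
  change ∫ x in Ωx, pderiv j.castSucc φ (x, t) = 0
  rw [setIntegral_eq_integral_of_forall_compl_eq_zero hs]
  have hsm : ContDiff ℝ ∞ (fun x : Fin 3 → ℝ => φ (x, t)) := hφ.1.comp (by fun_prop)
  have hpi : Integrable (fun x => pderiv j.castSucc φ (x, t)) :=
    (hp.1.continuous.comp (by fun_prop)).integrable_of_hasCompactSupport hcp
  -- Integration by parts against the constant function `1`.
  have := integral_mul_fderiv_eq_neg_fderiv_mul_of_integrable (μ := (volume : Measure (Fin 3 → ℝ)))
    (f := fun _ => (1 : ℝ)) (g := fun x => φ (x, t)) (v := Pi.single j 1) (by simp)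
    (by simpa [fderiv_slice hφ.1] using hpi)
    (by simpa using hsm.continuous.integrable_of_hasCompactSupport hc)
    (fun _ _ => differentiableAt_const _) (fun x _ => hsm.differentiable (by simp) x)
  simpa [fderiv_slice hφ.1] using this

theorem integral_pderiv_last {Ωx : Set (Fin 3 → ℝ)} {t₀ T : ℝ} (ht : t₀ < T) {φ : Pt → ℝ}
    (hφ : IsTest (Ωx ×ˢ Set.Ioi t₀) φ) :
    ∫ y in cylinder Ωx t₀ T, pderiv (Fin.last 3) φ y = ∫ x in Ωx, φ (x, T) := by
  have hp := hφ.pderiv (Fin.last 3)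
  rw [setIntegral_cylinder
    (hp.1.continuous.integrable_of_hasCompactSupport hp.2.1).integrableOn]
  congr 1
  ext x
  rw [← integral_Ioc_eq_integral_Ioo, ← intervalIntegral.integral_of_le ht.le,
    intervalIntegral.integral_eq_sub_of_hasDerivAt (fun t _ => hasDerivAt_time hφ.1 x t)
      ((hp.1.continuous.comp (by fun_prop)).intervalIntegrable _ _)]
  have : φ (x, t₀) = 0 := image_eq_zero_of_notMem_tsupport fun h => lt_irrefl t₀ (hφ.2.2 h).2
  rw [this, sub_zero]

/-! ### Green's formula -/

theorem integrable_mul_of_memLp {X : Type*} [MeasurableSpace X] {μ : Measure X} {F φ : X → ℝ}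
    (hF : MemLp F 2 μ) (hφ : MemLp φ 2 μ) : Integrable (fun y => F y * φ y) μ :=
  hF.integrable_mul hφ

theorem integral_pderiv {Ωx : Set (Fin 3 → ℝ)} {t₀ T : ℝ} (ht : t₀ < T) {φ : Pt → ℝ}
    (hφ : IsTest (Ωx ×ˢ Set.Ioi t₀) φ) (i : Fin 4) :
    ∫ y in cylinder Ωx t₀ T, pderiv i φ y =
      if i = Fin.last 3 then ∫ x in Ωx, φ (x, T) else 0 := by
  split_ifs with hi
  · rw [hi, integral_pderiv_last ht hφ]
  · exact integral_pderiv_castSucc hφ hi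

theorem IsTest.mul {U : Set Pt} {φ ψ : Pt → ℝ} (hφ : IsTest U φ) (hψ : ContDiff ℝ ∞ ψ) :
    IsTest U (fun y => φ y * ψ y) :=
  ⟨hφ.1.mul hψ, hφ.2.1.mul_right, (tsupport_mul_subset_left).trans hφ.2.2⟩

theorem integral_pderiv_mul {Ωx : Set (Fin 3 → ℝ)} (ho : IsOpen Ωx)
    (hb : Bornology.IsBounded Ωx) {t₀ T : ℝ} (ht : t₀ < T) {φ ψ : Pt → ℝ}
    (hφ : IsTest (Ωx ×ˢ Set.Ioi t₀) φ) (hψ : ContDiff ℝ ∞ ψ) (i : Fin 4) :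
    ∫ y in cylinder Ωx t₀ T, pderiv i φ y * ψ y =
      -(∫ y in cylinder Ωx t₀ T, φ y * pderiv i ψ y) +
        if i = Fin.last 3 then ∫ x in Ωx, φ (x, T) * ψ (x, T) else 0 := by
  have h := integral_pderiv ht (hφ.mul hψ) i
  have hm {χ : Pt → ℝ} (hχ : Continuous χ) : MemLp χ 2 (volume.restrict (cylinder Ωx t₀ T)) :=
    memLp_restrict_of_continuous (isBounded_cylinder hb t₀ T)
      (isOpen_cylinder ho t₀ T).measurableSet hχ
  simp only [pderiv_mul hφ.1 hψ i] at h
  rw [integral_add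
    (integrable_mul_of_memLp (hm hφ.1.continuous) (hm (contDiff_pderiv hψ i).continuous))
    (integrable_mul_of_memLp (hm (contDiff_pderiv hφ.1 i).continuous) (hm hψ.continuous))] at h
  linarith

theorem IsSmoothDirichlet.isTest {k : ℕ} {Ωx : Set (Fin 3 → ℝ)} {t₀ : ℝ} {v : Pt → Form ℝ}
    (hv : IsSmoothDirichlet k Ωx t₀ v) (I : Finset (Fin 4)) :
    IsTest (Ωx ×ˢ Set.Ioi t₀) (fun y => v y I) := by
  have hs : tsupport (fun y => v y I) ⊆ tsupport v :=
    closure_mono fun y hy => Function.mem_support.2 fun h : v y = 0 =>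
      Function.mem_support.1 hy (by simp [h])
  exact ⟨hv.smooth I, hv.compact.of_isClosed_subset (isClosed_tsupport _) hs, hs.trans hv.support⟩

theorem IsSmoothDirichlet.continuous_extD {k : ℕ} {Ωx : Set (Fin 3 → ℝ)} {t₀ : ℝ}
    {v : Pt → Form ℝ} (hv : IsSmoothDirichlet k Ωx t₀ v) (J : Finset (Fin 4)) :
    Continuous (fun y => extD v y J) :=
  continuous_finsetSum _ fun i _ =>
    continuous_const.mul (contDiff_pderiv (hv.smooth (J.erase i)) i).continuous

theorem IsSmoothDirichlet.extD_eq_zero {k : ℕ} {Ωx : Set (Fin 3 → ℝ)} {t₀ : ℝ}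
    {v : Pt → Form ℝ} (hv : IsSmoothDirichlet k Ωx t₀ v) {J : Finset (Fin 4)}
    (hJ : J.card ≠ k + 1) (y : Pt) : extD v y J = 0 := by
  refine Finset.sum_eq_zero fun i hi => ?_
  have hc : (J.erase i).card ≠ k := by
    have := Finset.card_erase_add_one hi
    omega
  have : (fun z => v z (J.erase i)) = fun _ => 0 := funext fun z => hv.isForm z _ hc
  rw [this]
  simp [pderiv]

/-- `MemHD` does not prescribe the degree of `dv`; it is inherited from the smooth approximants in
the `L²` limit. -/
theorem MemHD.deriv_eq_zero {k : ℕ} {Ωx : Set (Fin 3 → ℝ)} {t₀ T : ℝ} {v dv : Pt → Form ℝ}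
    {g : (Fin 3 → ℝ) → Form ℝ} (h : MemHD k Ωx t₀ T v dv g) {J : Finset (Fin 4)}
    (hJ : J.card ≠ k + 1) : (fun y => dv y J) =ᵐ[volume.restrict (cylinder Ωx t₀ T)] 0 := by
  obtain ⟨vn, hvn, -, hd, -⟩ := h.approx
  have hJd := hd J
  simp only [fun n y => (hvn n).extD_eq_zero hJ y, zero_sub] at hJd
  have h0 := tendsto_nhds_unique tendsto_const_nhds hJd
  have := (eLpNorm_eq_zero_iff (h.deriv_memL2 J).1.neg (by simp)).1 h0
  filter_upwards [this] with y hy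
  simpa using hy

/-- Green's formula with the trace on `Γ_T`. -/
theorem MemHD.integral_deriv_mul {k : ℕ} {Ωx : Set (Fin 3 → ℝ)} (ho : IsOpen Ωx)
    (hb : Bornology.IsBounded Ωx) {t₀ T : ℝ} (ht : t₀ < T) {v dv : Pt → Form ℝ}
    {g : (Fin 3 → ℝ) → Form ℝ} (h : MemHD k Ωx t₀ T v dv g) (J : Finset (Fin 4)) {ψ : Pt → ℝ}
    (hψ : ContDiff ℝ ∞ ψ) :
    ∫ y in cylinder Ωx t₀ T, dv y J * ψ y =
      ∑ i ∈ J, (sgn {i} (J.erase i) : ℝ) *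
        (-(∫ y in cylinder Ωx t₀ T, v y (J.erase i) * pderiv i ψ y) +
          if i = Fin.last 3 then ∫ x in Ωx, g x (J.erase i) * ψ (x, T) else 0) := by
  obtain ⟨vn, hvn, hv, hd, hg⟩ := h.approx
  have hm {χ : Pt → ℝ} (hχ : Continuous χ) : MemLp χ 2 (volume.restrict (cylinder Ωx t₀ T)) :=
    memLp_restrict_of_continuous (isBounded_cylinder hb t₀ T)
      (isOpen_cylinder ho t₀ T).measurableSet hχ
  have hmx {χ : (Fin 3 → ℝ) → ℝ} (hχ : Continuous χ) : MemLp χ 2 (volume.restrict Ωx) :=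
    memLp_restrict_of_continuous hb ho.measurableSet hχ
  have hL := tendsto_integral_mul_of_tendsto_eLpNorm (fun n => hm ((hvn n).continuous_extD J))
    (h.deriv_memL2 J) (hm hψ.continuous) (hd J)
  refine tendsto_nhds_unique hL ?_
  have hn : ∀ n, ∫ y in cylinder Ωx t₀ T, extD (vn n) y J * ψ y =
      ∑ i ∈ J, (sgn {i} (J.erase i) : ℝ) *
        (-(∫ y in cylinder Ωx t₀ T, vn n y (J.erase i) * pderiv i ψ y) +
          if i = Fin.last 3 then ∫ x in Ωx, vn n (x, T) (J.erase i) * ψ (x, T) else 0) := by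
    intro n
    simp only [extD, Finset.sum_mul, mul_assoc]
    rw [integral_finsetSum]
    · refine Finset.sum_congr rfl fun i _ => ?_
      rw [integral_const_mul, integral_pderiv_mul ho hb ht ((hvn n).isTest (J.erase i)) hψ]
    · intro i _
      exact ((hm (contDiff_pderiv ((hvn n).smooth (J.erase i)) i).continuous).integrable_mul
        (hm hψ.continuous)).const_mul _
  simp only [hn]
  -- Each term is continuous in the norm that defines `MemHD`; the boundary term uses convergence of
  -- the traces.
  refine tendsto_finsetSum _ fun i _ => ((Tendsto.neg ?_).add ?_).const_mul _
  · exact tendsto_integral_mul_of_tendsto_eLpNorm (fun n => hm ((hvn n).smooth _).continuous)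
      (h.memL2 _) (hm (contDiff_pderiv hψ i).continuous) (hv _)
  · split_ifs with hi
    · subst hi
      refine tendsto_integral_mul_of_tendsto_eLpNorm
        (fun n => hmx (((hvn n).smooth _).continuous.comp (by fun_prop)))
        (h.trace_memL2 _) (hmx (hψ.continuous.comp (by fun_prop))) ?_
      -- Removing the time index leaves a coefficient without `dt`, which `tangential` does not
      -- change.
      simpa [tangential] using hg (J.erase (Fin.last 3))
    · exact tendsto_const_nhds

/-- The Green formula for the time derivative of a form without `dt`. -/
theorem MemHD.integral_time_deriv_mul {k : ℕ} {Ωx : Set (Fin 3 → ℝ)} (ho : IsOpen Ωx)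
    (hb : Bornology.IsBounded Ωx) {t₀ T : ℝ} (ht : t₀ < T) {v dv : Pt → Form ℝ}
    {g : (Fin 3 → ℝ) → Form ℝ} (h : MemHD k Ωx t₀ T v dv g)
    (hv : ∀ y ∈ cylinder Ωx t₀ T, NoDt (v y)) {A : Finset (Fin 4)} (hA : Fin.last 3 ∉ A)
    {ψ : Pt → ℝ} (hψ : ContDiff ℝ ∞ ψ) :
    (-1) ^ A.card * ∫ y in cylinder Ωx t₀ T, dv y (insert (Fin.last 3) A) * ψ y =
      (∫ x in Ωx, g x A * ψ (x, T)) -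
        ∫ y in cylinder Ωx t₀ T, v y A * pderiv (Fin.last 3) ψ y := by
  rw [h.integral_deriv_mul ho hb ht _ hψ, Finset.sum_insert hA, Finset.sum_eq_zero, add_zero,
    Finset.erase_insert hA, sgn_last A hA, if_pos rfl]
  · push_cast
    rw [← mul_assoc, ← mul_pow]
    simp
    ring
  -- A spatial direction `i` still leaves `dt` in the index, where `v` vanishes.
  · intro i hi
    have hne : i ≠ Fin.last 3 := fun h => hA (h ▸ hi)
    rw [if_neg hne, setIntegral_eq_zero_of_forall_eq_zero]
    · simp
    · intro y hy
      rw [hv y hy _ (Finset.mem_erase.2 ⟨hne.symm, Finset.mem_insert_self _ _⟩), zero_mul]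

/-! ### The scaled flux -/

/-- The coefficients of `** (*_α)` applied to the flux, up to the sign of `**`. -/
def scaledFlux (α : Pt → ℝ) (β : Pt → Fin 3 → ℝ) (ε : ℝ) (u du : Pt → Form ℝ) (y : Pt) : Form ℝ :=
  fun J => (if Fin.last 3 ∈ J then ε else α y) * flux α β ε u du y J

theorem hodgeScaled_flux (α : Pt → ℝ) (β : Pt → Fin 3 → ℝ) (ε : ℝ) (u du : Pt → Form ℝ) (y : Pt) :
    hodgeScaled (α y) ε (flux α β ε u du y) = hodge (scaledFlux α β ε u du y) := rfl

theorem convForm_eq (α : Pt → ℝ) (β : Pt → Fin 3 → ℝ) (ε : ℝ) (y : Pt) :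
    convForm α β ε y =
      oneForm (Fin.snoc (α := fun _ => ℝ) (fun j : Fin 3 => (α y)⁻¹ * β y j) (-ε⁻¹)) := rfl

theorem memLp_mul_of_bound {X : Type*} [MeasurableSpace X] {μ : Measure X} {c w : X → ℝ} {C : ℝ}
    (hc : AEStronglyMeasurable c μ) (hC : ∀ᵐ y ∂μ, |c y| ≤ C) (hw : MemLp w 2 μ) :
    MemLp (fun y => c y * w y) 2 μ := by
  refine hw.of_le_mul (c := C) (hc.mul hw.1) ?_
  filter_upwards [hC] with y hy
  rw [norm_mul]
  exact mul_le_mul_of_nonneg_right hy (norm_nonneg _)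

theorem scaledFlux_memL2 {U : Set Pt} (hU : MeasurableSet U) {α : Pt → ℝ} (hα : Measurable α)
    (hαb : ∃ α₀ α₁ : ℝ, 0 < α₀ ∧ ∀ y ∈ U, α₀ ≤ α y ∧ α y ≤ α₁)
    {β : Pt → Fin 3 → ℝ} (hβ : Measurable β) (hβb : ∃ M : ℝ, ∀ y ∈ U, ∀ i, |β y i| ≤ M) (ε : ℝ)
    {u du : Pt → Form ℝ} (hu : L2Form U u) (hdu : L2Form U du) :
    L2Form U (scaledFlux α β ε u du) := by
  obtain ⟨α₀, α₁, h0, hα'⟩ := hαb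
  obtain ⟨M, hM⟩ := hβb
  have hconv : ∀ i : Fin 4, Measurable (fun y => (Fin.snoc (α := fun _ => ℝ)
      (fun j : Fin 3 => (α y)⁻¹ * β y j) (-ε⁻¹) : Fin 4 → ℝ) i) ∧
      ∃ C, ∀ y ∈ U, |(Fin.snoc (α := fun _ => ℝ)
        (fun j : Fin 3 => (α y)⁻¹ * β y j) (-ε⁻¹) : Fin 4 → ℝ) i| ≤ C := by
    intro i
    refine Fin.lastCases ?_ (fun j => ?_) i
    · simp only [Fin.snoc_last]
      exact ⟨measurable_const, _, fun _ _ => le_rfl⟩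
    · simp only [Fin.snoc_castSucc]
      refine ⟨hα.inv.mul ((measurable_pi_apply j).comp hβ), α₀⁻¹ * M, fun y hy => ?_⟩
      rw [abs_mul, abs_inv, abs_of_pos (h0.trans_le (hα' y hy).1)]
      exact mul_le_mul (inv_anti₀ h0 (hα' y hy).1) (hM y hy j) (abs_nonneg _) (inv_pos.2 h0).le
  intro J
  have hflux : MemLp (fun y => flux α β ε u du y J) 2 (volume.restrict U) := by
    simp only [flux, Pi.add_apply, convForm_eq, wedge_oneForm]
    refine (hdu J).add (memLp_finsetSum _ fun i _ => ?_)
    obtain ⟨hm, C, hC⟩ := hconv i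
    simp only [mul_assoc]
    exact (memLp_mul_of_bound hm.aestronglyMeasurable
      ((ae_restrict_iff' hU).2 (ae_of_all _ hC)) (hu _)).const_mul _
  by_cases hJ : Fin.last 3 ∈ J
  · simp only [scaledFlux, if_pos hJ]
    exact hflux.const_mul _
  · simp only [scaledFlux, if_neg hJ]
    refine memLp_mul_of_bound (C := α₁) hα.aestronglyMeasurable
      ((ae_restrict_iff' hU).2 (ae_of_all _ fun y hy => ?_)) hflux
    rw [abs_of_pos (h0.trans_le (hα' y hy).1)]
    exact (hα' y hy).2

/-- The spatial part of `b` meets only coefficients of `u` with `dt`, which vanish, and the factor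
`ε` cancels the `-ε⁻¹` of `b`. The zeroth-order term in `u` produced here becomes the time
derivative of the evolution equation. -/
theorem scaledFlux_time {α : Pt → ℝ} {β : Pt → Fin 3 → ℝ} {ε : ℝ} (hε : ε ≠ 0)
    {u du : Pt → Form ℝ} {y : Pt} (hu : NoDt (u y)) {A : Finset (Fin 4)} (hA : Fin.last 3 ∉ A) :
    scaledFlux α β ε u du y (insert (Fin.last 3) A) =
      ε * du y (insert (Fin.last 3) A) - (-1) ^ A.card * u y A := by
  simp only [scaledFlux, if_pos (Finset.mem_insert_self _ _), flux, Pi.add_apply, convForm_eq,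
    wedge_oneForm]
  rw [Finset.sum_insert hA, Finset.sum_eq_zero, Finset.erase_insert hA, sgn_last A hA,
    Fin.snoc_last]
  · field_simp
    push_cast
    ring
  · intro i hi
    have hne : i ≠ Fin.last 3 := fun h => hA (h ▸ hi)
    rw [hu _ (Finset.mem_erase.2 ⟨hne.symm, Finset.mem_insert_self _ _⟩), mul_zero]

theorem scaledFlux_eq_zero {k : ℕ} {α : Pt → ℝ} {β : Pt → Fin 3 → ℝ} {ε : ℝ}
    {u du : Pt → Form ℝ} {y : Pt} (hu : IsForm k (u y)) {J : Finset (Fin 4)}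
    (hJ : J.card ≠ k + 1) (hdu : du y J = 0) : scaledFlux α β ε u du y J = 0 := by
  simp only [scaledFlux, flux, Pi.add_apply, convForm_eq, wedge_oneForm, hdu]
  rw [Finset.sum_eq_zero]
  · simp
  · intro i hi
    have := Finset.card_erase_add_one hi
    rw [hu _ (by omega), mul_zero]

/-! ### The weak codifferential -/

/-- The weak codifferential of `F`: the pairing of `F` with `d (φ dx^I)`. -/
def weakCodiff (U : Set Pt) (F : Pt → Form ℝ) (I : Finset (Fin 4)) (φ : Pt → ℝ) : ℝ :=
  ∑ i ∈ Iᶜ, (sgn {i} I : ℝ) * ∫ y in U, F y (insert i I) * pderiv i φ y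

theorem distD_eq_sum {U : Set Pt} (hU : Bornology.IsBounded U) (hm : MeasurableSet U)
    {w : Pt → Form ℝ} (hw : L2Form U w) {φ : Pt → ℝ} (hφ : ContDiff ℝ ∞ φ) (J : Finset (Fin 4)) :
    distD U w J φ =
      -∑ i ∈ J, (sgn {i} (J.erase i) : ℝ) * ∫ y in U, w y (J.erase i) * pderiv i φ y := by
  simp only [distD, mul_assoc]
  rw [integral_finsetSum]
  · simp only [integral_const_mul]
  · intro i _
    exact (integrable_mul_of_memLp (hw _) (memLp_restrict_of_continuous hU hm
      (contDiff_pderiv hφ i).continuous)).const_mul _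

theorem L2Form.hodge {U : Set Pt} {w : Pt → Form ℝ} (hw : L2Form U w) :
    L2Form U (fun y => hodge (w y)) := by
  intro I
  simp only [SpaceTime.hodge, zsmul_eq_mul]
  exact (hw _).const_mul _

/-- Complementation carries the erased index to an inserted one, and `sgn_singleton_compl` collects
the three signs. -/
theorem hodge_distD_hodge {U : Set Pt} (hU : Bornology.IsBounded U) (hm : MeasurableSet U)
    {w : Pt → Form ℝ} (hw : L2Form U w) {φ : Pt → ℝ} (hφ : ContDiff ℝ ∞ φ) (I : Finset (Fin 4)) :
    (sgn Iᶜ I : ℝ) * distD U (fun y => hodge (w y)) Iᶜ φ = -weakCodiff U w I φ := by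
  rw [distD_eq_sum hU hm hw.hodge hφ, weakCodiff, mul_neg, Finset.mul_sum]
  congr 1
  refine Finset.sum_congr rfl fun i hi => ?_
  have hi' : i ∉ I := Finset.mem_compl.1 hi
  have hc : (Iᶜ.erase i)ᶜ = insert i I := by rw [Finset.compl_erase, compl_compl]
  have hs := congrArg (Int.cast : ℤ → ℝ) (sgn_singleton_compl I i hi')
  push_cast at hs
  simp only [hodge, zsmul_eq_mul, hc, mul_assoc]
  rw [integral_const_mul, ← hs]
  ring

theorem codiffOneAlpha_flux {U : Set Pt} (hU : Bornology.IsBounded U) (hm : MeasurableSet U)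
    {α : Pt → ℝ} {β : Pt → Fin 3 → ℝ} {ε : ℝ} {u du : Pt → Form ℝ}
    (hS : L2Form U (scaledFlux α β ε u du)) {φ : Pt → ℝ} (hφ : ContDiff ℝ ∞ φ)
    (I : Finset (Fin 4)) :
    codiffOneAlpha U α ε (flux α β ε u du) I φ = weakCodiff U (scaledFlux α β ε u du) I φ := by
  have h := hodge_distD_hodge hU hm hS hφ I
  simp only [codiffOneAlpha, hodgeScaled_flux, Pi.neg_apply]
  rw [hodge, zsmul_eq_mul]
  simp only [Pi.mul_apply, Pi.intCast_apply]
  rw [h, neg_neg]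

/-- Green's formula in time with `ψ = ∂_i φ` moves the derivative from the `dt` part of `d u` to the
test function; `hφT` removes the trace. With `D` the weak codifferential of `u`, the result is the
weak form of `D - ε ∂_t D`, up to a sign. -/
theorem weakCodiff_time {k : ℕ} {Ωx : Set (Fin 3 → ℝ)} (ho : IsOpen Ωx)
    (hb : Bornology.IsBounded Ωx) {t₀ T : ℝ} (ht : t₀ < T) {α : Pt → ℝ} {β : Pt → Fin 3 → ℝ}
    {ε : ℝ} (hε : ε ≠ 0) {u du : Pt → Form ℝ} {g : (Fin 3 → ℝ) → Form ℝ}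
    (h : MemHD k Ωx t₀ T u du g) (hu : ∀ y ∈ cylinder Ωx t₀ T, NoDt (u y))
    {K : Finset (Fin 4)} (hK : Fin.last 3 ∉ K) {φ : Pt → ℝ} (hφ : ContDiff ℝ ∞ φ)
    (hφT : ∀ i x, pderiv i φ (x, T) = 0) :
    weakCodiff (cylinder Ωx t₀ T) (scaledFlux α β ε u du) (insert (Fin.last 3) K) φ =
      (-1) ^ K.card * (ε * weakCodiff (cylinder Ωx t₀ T) u K (pderiv (Fin.last 3) φ) +
        weakCodiff (cylinder Ωx t₀ T) u K φ) := by
  have hm {χ : Pt → ℝ} (hχ : ContDiff ℝ ∞ χ) : MemLp χ 2 (volume.restrict (cylinder Ωx t₀ T)) :=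
    memLp_restrict_of_continuous (isBounded_cylinder hb t₀ T)
      (isOpen_cylinder ho t₀ T).measurableSet hχ.continuous
  -- The direction `dt` drops out of the codifferential of `u`, so both sides are sums over the same
  -- spatial directions.
  have hKc : Kᶜ = insert (Fin.last 3) (insert (Fin.last 3) K)ᶜ := by
    ext i
    by_cases hi : i = Fin.last 3 <;> simp_all
  have hz : ∀ ψ : Pt → ℝ,
      ∫ y in cylinder Ωx t₀ T, u y (insert (Fin.last 3) K) * ψ y = 0 := fun ψ =>
    setIntegral_eq_zero_of_forall_eq_zero fun y hy => by
      rw [hu y hy _ (Finset.mem_insert_self _ _), zero_mul]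
  have hD : ∀ ψ : Pt → ℝ, weakCodiff (cylinder Ωx t₀ T) u K ψ =
      ∑ i ∈ (insert (Fin.last 3) K)ᶜ,
        (sgn {i} K : ℝ) * ∫ y in cylinder Ωx t₀ T, u y (insert i K) * pderiv i ψ y := by
    intro ψ
    rw [weakCodiff, hKc, Finset.sum_insert (by simp), hz, mul_zero, zero_add]
  rw [hD, hD, Finset.mul_sum, ← Finset.sum_add_distrib, Finset.mul_sum, weakCodiff]
  refine Finset.sum_congr rfl fun i hi => ?_
  simp only [Finset.mem_compl, Finset.mem_insert, not_or] at hi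
  have hA : Fin.last 3 ∉ insert i K := fun h' =>
    (Finset.mem_insert.1 h').elim (fun e => hi.1 e.symm) hK
  have hG := h.integral_time_deriv_mul ho hb ht hu hA (contDiff_pderiv hφ i)
  simp only [hφT, mul_zero, integral_zero, zero_sub, Finset.card_insert_of_notMem hi.2] at hG
  rw [sgn_singleton_insert_last i K hi.1, Finset.insert_comm,
    setIntegral_congr_fun (isOpen_cylinder ho t₀ T).measurableSet
      (g := fun y => ε * (du y (insert (Fin.last 3) (insert i K)) * pderiv i φ y) -
        (-1) ^ (K.card + 1) * (u y (insert i K) * pderiv i φ y))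
      (fun y hy => by
        simp only [scaledFlux_time hε (hu y hy) hA, Finset.card_insert_of_notMem hi.2]
        ring),
    integral_sub ((integrable_mul_of_memLp (h.deriv_memL2 _) (hm (contDiff_pderiv hφ i))).const_mul _)
      ((integrable_mul_of_memLp (h.memL2 _) (hm (contDiff_pderiv hφ i))).const_mul _),
    integral_const_mul, integral_const_mul, pderiv_comm hφ i (Fin.last 3)]
  have hs : ((-1 : ℝ) ^ K.card) * (-1) ^ K.card = 1 := by
    rw [← mul_pow]; simp
  linear_combination (-(sgn {i} K : ℝ) * ε * (-1) ^ K.card) * hG -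
    (sgn {i} K : ℝ) * ε * (∫ y in cylinder Ωx t₀ T,
      du y (insert (Fin.last 3) (insert i K)) * pderiv i φ y) * hs

/-! ### The variational problem, tested coefficientwise -/

theorem innerL2_eq_sum {X : Type*} [MeasureSpace X] {U : Set X} {u v : X → Form ℝ}
    (hu : L2Form U u) (hv : L2Form U v) :
    innerL2 U u v = ∑ I, ∫ y in U, u y I * v y I := by
  simp only [innerL2, wedge_hodge_univ]
  exact integral_finsetSum _ fun I _ => integrable_mul_of_memLp (hu I) (hv I)

theorem bilin_eq_sum {k : ℕ} {Ωx : Set (Fin 3 → ℝ)} {t₀ T : ℝ} {α : Pt → ℝ}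
    {β : Pt → Fin 3 → ℝ} {ε : ℝ} {u du dv : Pt → Form ℝ} {g h : (Fin 3 → ℝ) → Form ℝ}
    (hS : L2Form (cylinder Ωx t₀ T) (scaledFlux α β ε u du)) (hdv : L2Form (cylinder Ωx t₀ T) dv)
    (hdv0 : ∀ J : Finset (Fin 4), J.card ≠ k + 1 →
      (fun y => dv y J) =ᵐ[volume.restrict (cylinder Ωx t₀ T)] 0)
    (hg : L2Form Ωx g) (hh : L2Form Ωx h) :
    bilin k Ωx t₀ T α β ε u du g dv h =
      (∑ J, ∫ y in cylinder Ωx t₀ T, scaledFlux α β ε u du y J * dv y J) +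
        ∑ I, ∫ x in Ωx, g x I * h x I := by
  have hSS : L2Form (cylinder Ωx t₀ T)
      (fun y => hodge (hodgeScaled (α y) ε (flux α β ε u du y))) := hS.hodge.hodge
  rw [bilin, innerL2_eq_sum hSS hdv, innerL2_eq_sum hg hh, Finset.mul_sum]
  congr 1
  refine Finset.sum_congr rfl fun J _ => ?_
  by_cases hJ : J.card = k + 1
  · simp only [hodgeScaled_flux, hodge, zsmul_eq_mul, compl_compl, mul_assoc]
    rw [integral_const_mul, integral_const_mul]
    have := neg_one_zpow_mul_sgn hJ
    linear_combination (∫ y in cylinder Ωx t₀ T, scaledFlux α β ε u du y J * dv y J) * this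
  -- In the other degrees the signs need not cancel, but `dv` vanishes there.
  · rw [integral_eq_zero_of_ae, integral_eq_zero_of_ae, mul_zero]
    · filter_upwards [hdv0 J hJ] with y hy
      simp [hy]
    · filter_upwards [hdv0 J hJ] with y hy
      simp [hy]

theorem IsSmoothDirichlet.memHD {k : ℕ} {Ωx : Set (Fin 3 → ℝ)} (ho : IsOpen Ωx)
    (hb : Bornology.IsBounded Ωx) {t₀ : ℝ} (T : ℝ) {v : Pt → Form ℝ}
    (hv : IsSmoothDirichlet k Ωx t₀ v) :
    MemHD k Ωx t₀ T v (extD v) (fun x => tangential (v (x, T))) := by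
  have hm {χ : Pt → ℝ} (hχ : Continuous χ) : MemLp χ 2 (volume.restrict (cylinder Ωx t₀ T)) :=
    memLp_restrict_of_continuous (isBounded_cylinder hb t₀ T)
      (isOpen_cylinder ho t₀ T).measurableSet hχ
  refine ⟨fun I => hm (hv.smooth I).continuous, fun J => hm (hv.continuous_extD J), fun I => ?_,
    fun _ => v, fun _ => hv, ?_, ?_, ?_⟩
  · refine memLp_restrict_of_continuous hb ho.measurableSet ?_
    simp only [tangential]
    split_ifs
    · exact continuous_const
    · exact (hv.smooth I).continuous.comp (by fun_prop)
  all_goals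
    intro I
    simp

theorem sum_integral_mul_extD {k : ℕ} {Ωx : Set (Fin 3 → ℝ)} (ho : IsOpen Ωx)
    (hb : Bornology.IsBounded Ωx) {t₀ T : ℝ} {S v : Pt → Form ℝ}
    (hS : L2Form (cylinder Ωx t₀ T) S) (hv : IsSmoothDirichlet k Ωx t₀ v) :
    ∑ J, ∫ y in cylinder Ωx t₀ T, S y J * extD v y J =
      ∑ I, weakCodiff (cylinder Ωx t₀ T) S I (fun y => v y I) := by
  have hm {χ : Pt → ℝ} (hχ : Continuous χ) : MemLp χ 2 (volume.restrict (cylinder Ωx t₀ T)) :=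
    memLp_restrict_of_continuous (isBounded_cylinder hb t₀ T)
      (isOpen_cylinder ho t₀ T).measurableSet hχ
  have h1 : ∀ J, ∫ y in cylinder Ωx t₀ T, S y J * extD v y J =
      ∑ i ∈ J, (sgn {i} (J.erase i) : ℝ) *
        ∫ y in cylinder Ωx t₀ T, S y J * pderiv i (fun z => v z (J.erase i)) y := by
    intro J
    simp only [extD, Finset.mul_sum, ← integral_const_mul]
    rw [integral_finsetSum]
    · refine Finset.sum_congr rfl fun i _ => integral_congr_ae (ae_of_all _ fun y => ?_)
      simp only
      ring
    · intro i _
      refine integrable_mul_of_memLp (hS J) (hm ?_)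
      exact continuous_const.mul (contDiff_pderiv (hv.smooth _) i).continuous
  simp only [h1]
  rw [sum_erase_eq_sum_insert (fun J i I => (sgn {i} I : ℝ) *
    ∫ y in cylinder Ωx t₀ T, S y J * pderiv i (fun z => v z I) y)]
  rfl

/-- The variational problem, for test forms with a single smooth coefficient. -/
def WeakEquation (k : ℕ) (Ωx : Set (Fin 3 → ℝ)) (t₀ T : ℝ) (S f : Pt → Form ℝ)
    (g : (Fin 3 → ℝ) → Form ℝ) : Prop :=
  ∀ I : Finset (Fin 4), I.card = k → ∀ φ : Pt → ℝ, IsTest (Ωx ×ˢ Set.Ioi t₀) φ →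
    weakCodiff (cylinder Ωx t₀ T) S I φ +
      (if Fin.last 3 ∈ I then 0 else ∫ x in Ωx, g x I * φ (x, T)) =
    ∫ y in cylinder Ωx t₀ T, f y I * φ y

theorem pderiv_zero (i : Fin 4) (y : Pt) : pderiv i (fun _ => 0) y = 0 := by
  simp [pderiv]

theorem weakCodiff_zero (U : Set Pt) (F : Pt → Form ℝ) (I : Finset (Fin 4)) :
    weakCodiff U F I (fun _ => 0) = 0 := by
  simp [weakCodiff, pderiv_zero]

theorem isSmoothDirichlet_single {k : ℕ} {Ωx : Set (Fin 3 → ℝ)} {t₀ : ℝ} {φ : Pt → ℝ}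
    (hφ : IsTest (Ωx ×ˢ Set.Ioi t₀) φ) {I : Finset (Fin 4)} (hI : I.card = k) :
    IsSmoothDirichlet k Ωx t₀ (fun y J => if J = I then φ y else 0) := by
  have hs : tsupport (fun y (J : Finset (Fin 4)) => if J = I then φ y else 0) ⊆ tsupport φ :=
    closure_mono fun y hy => Function.mem_support.2 fun h : φ y = 0 =>
      Function.mem_support.1 hy (by funext J; simp [h])
  refine ⟨fun y J hJ => if_neg fun h : J = I => hJ (h ▸ hI), fun J => ?_,
    hφ.2.1.of_isClosed_subset (isClosed_tsupport _) hs, hs.trans hφ.2.2⟩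
  split_ifs
  · exact hφ.1
  · exact contDiff_const

/-- One direction tests with a form having a single nonzero coefficient. For the other, the identity
is summed over the coefficients of smooth forms and passes to the limit, since both sides are
continuous in the norm that defines `MemHD`. -/
theorem forall_bilin_eq_iff_weakEquation {k : ℕ} {Ωx : Set (Fin 3 → ℝ)} (ho : IsOpen Ωx)
    (hb : Bornology.IsBounded Ωx) {t₀ T : ℝ} {α : Pt → ℝ}
    {β : Pt → Fin 3 → ℝ} {ε : ℝ} {f u du : Pt → Form ℝ} {g : (Fin 3 → ℝ) → Form ℝ}
    (hS : L2Form (cylinder Ωx t₀ T) (scaledFlux α β ε u du)) (hf : L2Form (cylinder Ωx t₀ T) f)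
    (hg : L2Form Ωx g) :
    (∀ (v dv : Pt → Form ℝ) (h : (Fin 3 → ℝ) → Form ℝ), MemHD k Ωx t₀ T v dv h →
      bilin k Ωx t₀ T α β ε u du g dv h = innerL2 (cylinder Ωx t₀ T) f v) ↔
    WeakEquation k Ωx t₀ T (scaledFlux α β ε u du) f g := by
  have hsm : ∀ v, IsSmoothDirichlet k Ωx t₀ v →
      bilin k Ωx t₀ T α β ε u du g (extD v) (fun x => tangential (v (x, T))) =
        ∑ I, (weakCodiff (cylinder Ωx t₀ T) (scaledFlux α β ε u du) I (fun y => v y I) +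
          if Fin.last 3 ∈ I then 0 else ∫ x in Ωx, g x I * v (x, T) I) := by
    intro v hv
    have hH := hv.memHD ho hb T
    rw [bilin_eq_sum hS hH.deriv_memL2 (fun J hJ => hH.deriv_eq_zero hJ) hg hH.trace_memL2,
      sum_integral_mul_extD ho hb hS hv, Finset.sum_add_distrib]
    congr 1
    refine Finset.sum_congr rfl fun I _ => ?_
    by_cases hI : Fin.last 3 ∈ I <;> simp [tangential, hI, -Fin.reduceLast]
  constructor
  · intro h I hI φ hφ
    have hv := isSmoothDirichlet_single hφ hI
    have hH := hv.memHD ho hb T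
    have := h _ _ _ hH
    rw [hsm _ hv, innerL2_eq_sum hf hH.memL2, Finset.sum_eq_single I, Finset.sum_eq_single I] at this
    · simpa using this
    · intro J _ hJ
      simp [hJ]
    · simp
    · intro J _ hJ
      simp [hJ, weakCodiff_zero]
    · simp
  · intro h v dv w hv
    obtain ⟨vn, hvn, h1, h2, h3⟩ := hv.approx
    have hn : ∀ n, bilin k Ωx t₀ T α β ε u du g (extD (vn n))
        (fun x => tangential (vn n (x, T))) = innerL2 (cylinder Ωx t₀ T) f (vn n) := by
      intro n
      rw [hsm _ (hvn n), innerL2_eq_sum hf ((hvn n).memHD ho hb T).memL2]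
      refine Finset.sum_congr rfl fun I _ => ?_
      by_cases hI : I.card = k
      · exact h I hI _ ((hvn n).isTest I)
      · simp [(hvn n).isForm _ I hI, weakCodiff_zero]
    have hB : Tendsto (fun n => bilin k Ωx t₀ T α β ε u du g (extD (vn n))
        (fun x => tangential (vn n (x, T)))) atTop (𝓝 (bilin k Ωx t₀ T α β ε u du g dv w)) := by
      rw [bilin_eq_sum hS hv.deriv_memL2 (fun J hJ => hv.deriv_eq_zero hJ) hg hv.trace_memL2]
      have : ∀ n, _ := fun n => bilin_eq_sum hS ((hvn n).memHD ho hb T).deriv_memL2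
        (fun J hJ => ((hvn n).memHD ho hb T).deriv_eq_zero hJ) hg
        ((hvn n).memHD ho hb T).trace_memL2
      simp only [this]
      refine (tendsto_finsetSum _ fun J _ => ?_).add (tendsto_finsetSum _ fun I _ => ?_)
      · simp only [mul_comm (scaledFlux α β ε u du _ J)]
        exact tendsto_integral_mul_of_tendsto_eLpNorm
          (fun n => ((hvn n).memHD ho hb T).deriv_memL2 J) (hv.deriv_memL2 J) (hS J) (h2 J)
      · simp only [mul_comm (g _ I)]
        exact tendsto_integral_mul_of_tendsto_eLpNorm
          (fun n => ((hvn n).memHD ho hb T).trace_memL2 I) (hv.trace_memL2 I) (hg I) (h3 I)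
    have hR : Tendsto (fun n => innerL2 (cylinder Ωx t₀ T) f (vn n)) atTop
        (𝓝 (innerL2 (cylinder Ωx t₀ T) f v)) := by
      rw [innerL2_eq_sum hf hv.memL2]
      have : ∀ n, _ := fun n => innerL2_eq_sum hf ((hvn n).memHD ho hb T).memL2
      simp only [this]
      refine tendsto_finsetSum _ fun I _ => ?_
      simp only [mul_comm (f _ I)]
      exact tendsto_integral_mul_of_tendsto_eLpNorm
        (fun n => ((hvn n).memHD ho hb T).memL2 I) (hv.memL2 I) (hf I) (h1 I)
    simp only [hn] at hB
    exact tendsto_nhds_unique hB hR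

/-! ### Cutoff in time -/

/-- A smooth cutoff, vanishing for `n s ≤ 1` and equal to `1` for `2 ≤ n s`. -/
def cutoff (n : ℕ) (s : ℝ) : ℝ := Real.smoothTransition (n * s - 1)

theorem contDiff_cutoff (n : ℕ) : ContDiff ℝ ∞ (cutoff n) :=
  Real.smoothTransition.contDiff.comp ((contDiff_const.mul contDiff_id).sub contDiff_const)

theorem abs_cutoff_le (n : ℕ) (s : ℝ) : |cutoff n s| ≤ 1 := by
  rw [cutoff, abs_of_nonneg (Real.smoothTransition.nonneg _)]
  exact Real.smoothTransition.le_one _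

theorem eventually_two_lt_mul {s : ℝ} (hs : 0 < s) : ∀ᶠ n : ℕ in atTop, 2 < n * s :=
  (tendsto_natCast_atTop_atTop.atTop_mul_const hs).eventually_gt_atTop 2

theorem tendsto_cutoff {s : ℝ} (hs : 0 < s) :
    Tendsto (fun n => cutoff n s) atTop (𝓝 1) := by
  refine tendsto_const_nhds.congr' ?_
  filter_upwards [eventually_two_lt_mul hs] with n hn
  exact (Real.smoothTransition.one_of_one_le (by linarith)).symm

/-- A closed condition, hence inherited by the topological support, which therefore stays away from
`s = 0`. -/
theorem pos_of_cutoff_ne_zero {n : ℕ} {s : ℝ} (h : cutoff n s ≠ 0) : 1 ≤ n * s := by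
  by_contra hlt
  exact h (Real.smoothTransition.zero_of_nonpos (by linarith))

theorem IsTest.mul_of_support {U V C : Set Pt} {φ θ : Pt → ℝ} (hφ : IsTest U φ)
    (hθ : ContDiff ℝ ∞ θ) (hC : IsClosed C) (hs : Function.support θ ⊆ C) (hV : U ∩ C ⊆ V) :
    IsTest V (fun y => φ y * θ y) := by
  refine ⟨hφ.1.mul hθ, hφ.2.1.mul_right, fun y hy => hV ⟨hφ.2.2 ?_, ?_⟩⟩
  · exact tsupport_mul_subset_left hy
  · exact closure_minimal hs hC (tsupport_mul_subset_right hy)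

theorem IsTest.mul_upper_cutoff {Ωx : Set (Fin 3 → ℝ)} {I : Set ℝ} {T : ℝ} {φ : Pt → ℝ}
    (hφ : IsTest (Ωx ×ˢ I) φ) (n : ℕ) :
    IsTest (Ωx ×ˢ (I ∩ Set.Iio T)) (fun y => φ y * cutoff n (T - y.2)) := by
  refine hφ.mul_of_support (C := {y : Pt | 1 ≤ n * (T - y.2)})
    ((contDiff_cutoff n).comp (contDiff_const.sub contDiff_snd))
    (isClosed_le continuous_const (by fun_prop)) (fun y hy => pos_of_cutoff_ne_zero hy) ?_
  rintro y ⟨hy, hC⟩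
  refine ⟨hy.1, hy.2, ?_⟩
  have : 0 < T - y.2 := by
    by_contra h
    have := mul_nonpos_of_nonneg_of_nonpos (Nat.cast_nonneg (α := ℝ) n) (not_lt.1 h)
    have hC' : 1 ≤ n * (T - y.2) := hC
    linarith
  exact sub_pos.1 this

theorem IsTest.mul_lower_cutoff {Ωx : Set (Fin 3 → ℝ)} {I : Set ℝ} {t₀ : ℝ} {φ : Pt → ℝ}
    (hφ : IsTest (Ωx ×ˢ I) φ) (n : ℕ) :
    IsTest (Ωx ×ˢ (I ∩ Set.Ioi t₀)) (fun y => φ y * cutoff n (y.2 - t₀)) := by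
  refine hφ.mul_of_support (C := {y : Pt | 1 ≤ n * (y.2 - t₀)})
    ((contDiff_cutoff n).comp (contDiff_snd.sub contDiff_const))
    (isClosed_le continuous_const (by fun_prop)) (fun y hy => pos_of_cutoff_ne_zero hy) ?_
  rintro y ⟨hy, hC⟩
  refine ⟨hy.1, hy.2, ?_⟩
  have : 0 < y.2 - t₀ := by
    by_contra h
    have := mul_nonpos_of_nonneg_of_nonpos (Nat.cast_nonneg (α := ℝ) n) (not_lt.1 h)
    have hC' : 1 ≤ n * (y.2 - t₀) := hC
    linarith
  exact sub_pos.1 this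

theorem tendsto_setIntegral_mul_of_bounded {X : Type*} [MeasurableSpace X] {μ : Measure X}
    {U : Set X} (hU : MeasurableSet U) {F : X → ℝ} (hF : IntegrableOn F U μ) {G : ℕ → X → ℝ}
    {C c : ℝ} (hG : ∀ n, AEStronglyMeasurable (G n) (μ.restrict U))
    (hC : ∀ n, ∀ y ∈ U, |G n y| ≤ C) (hc : ∀ y ∈ U, Tendsto (fun n => G n y) atTop (𝓝 c)) :
    Tendsto (fun n => ∫ y in U, F y * G n y ∂μ) atTop (𝓝 (∫ y in U, F y * c ∂μ)) := by
  refine tendsto_integral_of_dominated_convergence (fun y => |F y| * C)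
    (fun n => hF.1.mul (hG n)) (hF.abs.mul_const C) (fun n => ?_) ?_
  · refine (ae_restrict_iff' hU).2 (ae_of_all _ fun y hy => ?_)
    rw [norm_mul]
    exact mul_le_mul_of_nonneg_left (hC n y hy) (abs_nonneg _)
  · exact (ae_restrict_iff' hU).2 (ae_of_all _ fun y hy => (hc y hy).const_mul _)

/-- As `dt` already occurs in the index, only spatial derivatives fall on the test function. A
cutoff in time is never differentiated and disappears by dominated convergence at both ends. For the
divergence of `u` this amounts to a zero initial value. -/
theorem weakCodiff_eq_zero_of_cylinder {Ωx : Set (Fin 3 → ℝ)} (ho : IsOpen Ωx)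
    (hb : Bornology.IsBounded Ωx) {t₀ T : ℝ} {S : Pt → Form ℝ}
    (hS : L2Form (cylinder Ωx t₀ T) S) {I : Finset (Fin 4)} (hI : Fin.last 3 ∈ I)
    (h : ∀ φ, IsTest (cylinder Ωx t₀ T) φ → weakCodiff (cylinder Ωx t₀ T) S I φ = 0)
    {φ : Pt → ℝ} (hφ : IsTest (Ωx ×ˢ Set.univ) φ) :
    weakCodiff (cylinder Ωx t₀ T) S I φ = 0 := by
  have hU := (isOpen_cylinder ho t₀ T).measurableSet
  have hm {χ : Pt → ℝ} (hχ : Continuous χ) : MemLp χ 2 (volume.restrict (cylinder Ωx t₀ T)) :=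
    memLp_restrict_of_continuous (isBounded_cylinder hb t₀ T) hU hχ
  let θ : ℕ → ℝ → ℝ := fun n t => cutoff n (t - t₀) * cutoff n (T - t)
  have hθ : ∀ n, ContDiff ℝ ∞ (θ n) := fun n =>
    ((contDiff_cutoff n).comp (contDiff_id.sub contDiff_const)).mul
      ((contDiff_cutoff n).comp (contDiff_const.sub contDiff_id))
  have hn : ∀ n, weakCodiff (cylinder Ωx t₀ T) S I (fun y => φ y * θ n y.2) = 0 := by
    intro n
    refine h _ ?_
    have := (hφ.mul_lower_cutoff (t₀ := t₀) n).mul_upper_cutoff (T := T) n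
    simp only [Set.univ_inter, Set.Ioi_inter_Iio, mul_assoc] at this
    exact this
  have hlim : Tendsto (fun n => weakCodiff (cylinder Ωx t₀ T) S I (fun y => φ y * θ n y.2)) atTop
      (𝓝 (weakCodiff (cylinder Ωx t₀ T) S I φ)) := by
    refine tendsto_finsetSum _ fun i hi => Tendsto.const_mul _ ?_
    have hne : i ≠ Fin.last 3 := fun e => Finset.mem_compl.1 hi (e ▸ hI)
    have hp : ∀ n y, pderiv i (fun z => φ z * θ n z.2) y = pderiv i φ y * θ n y.2 := by
      intro n y
      rw [pderiv_mul (ψ := fun z => θ n z.2) hφ.1 ((hθ n).comp contDiff_snd), pderiv_castSucc_comp_snd _ (hθ n) hne,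
        mul_zero, zero_add]
    simp only [hp, ← mul_assoc]
    have := tendsto_setIntegral_mul_of_bounded (μ := volume) hU (C := 1) (c := 1)
      (integrable_mul_of_memLp (hS (insert i I)) (hm (contDiff_pderiv hφ.1 i).continuous))
      (G := fun n y => θ n y.2) (fun n => ((hθ n).continuous.comp continuous_snd).aestronglyMeasurable)
      (fun n y _ => by
        simp only [θ, abs_mul]
        exact mul_le_one₀ (abs_cutoff_le _ _) (abs_nonneg _) (abs_cutoff_le _ _))
      (fun y hy => by
        have := (tendsto_cutoff (sub_pos.2 hy.2.1)).mul (tendsto_cutoff (sub_pos.2 hy.2.2))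
        simpa using this)
    simpa using this
  simp only [hn] at hlim
  exact tendsto_nhds_unique hlim tendsto_const_nhds

/-! ### Translation in time -/

theorem IsTest.time_shift {U V : Set Pt} {φ : Pt → ℝ} (hφ : IsTest U φ) (τ : ℝ)
    (hV : ∀ y : Pt, y + (0, τ) ∈ U → y ∈ V) : IsTest V (fun y => φ (y + (0, τ))) := by
  let e : Pt ≃ₜ Pt := Homeomorph.addRight (0, τ)
  refine ⟨hφ.1.comp (contDiff_id.add contDiff_const), hφ.2.1.comp_homeomorph e, fun y hy => ?_⟩
  rw [show (fun y => φ (y + (0, τ))) = φ ∘ e from rfl, tsupport_comp_eq_preimage] at hy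
  exact hV y (hφ.2.2 hy)

theorem pderiv_time_shift (φ : Pt → ℝ) (τ : ℝ) (i : Fin 4) :
    pderiv i (fun y => φ (y + (0, τ))) = fun y => pderiv i φ (y + (0, τ)) := by
  ext y
  rw [pderiv, fderiv_comp_add_right]
  rfl

theorem hasDerivAt_integral_time_shift {U : Set Pt} {w : Pt → ℝ} (hw : IntegrableOn w U)
    {ψ : Pt → ℝ} (hψ : ContDiff ℝ ∞ ψ) (hc : HasCompactSupport ψ) (τ : ℝ) :
    HasDerivAt (fun s => ∫ y in U, w y * ψ (y + (0, s)))
      (∫ y in U, w y * pderiv (Fin.last 3) ψ (y + (0, τ))) τ := by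
  have hp : IsTest Set.univ (pderiv (Fin.last 3) ψ) :=
    IsTest.pderiv ⟨hψ, hc, Set.subset_univ _⟩ _
  obtain ⟨C, hC⟩ := hp.2.1.exists_bound_of_continuous hp.1.continuous
  obtain ⟨D, hD⟩ := hc.exists_bound_of_continuous hψ.continuous
  have hcont (s : ℝ) {χ : Pt → ℝ} (hχ : Continuous χ) : Continuous (fun y => χ (y + (0, s))) :=
    hχ.comp (continuous_id.add continuous_const)
  refine (hasDerivAt_integral_of_dominated_loc_of_deriv_le (s := Set.univ)
    (bound := fun y => |w y| * C)
    (F' := fun s y => w y * pderiv (Fin.last 3) ψ (y + (0, s))) univ_mem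
    (Eventually.of_forall fun s => hw.1.mul (hcont s hψ.continuous).aestronglyMeasurable)
    ?_ (hw.1.mul (hcont τ hp.1.continuous).aestronglyMeasurable)
    (ae_of_all _ fun y s _ => ?_) (hw.abs.mul_const C) (ae_of_all _ fun y s _ => ?_)).2
  · exact hw.mul_bdd (c := D) (hcont τ hψ.continuous).aestronglyMeasurable
      (ae_of_all _ fun y => hD _)
  · rw [norm_mul]
    exact mul_le_mul_of_nonneg_left (hC _) (abs_nonneg _)
  · refine HasDerivAt.const_mul _ ?_
    have h := (hasDerivAt_time hψ y.1 (y.2 + s)).comp_const_add y.2 s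
    simpa [Prod.add_def] using h

theorem hasDerivAt_weakCodiff_time_shift {U : Set Pt} {u : Pt → Form ℝ}
    (hu : ∀ I, IntegrableOn (fun y => u y I) U) {V : Set Pt} {φ : Pt → ℝ} (hφ : IsTest V φ)
    (K : Finset (Fin 4)) (τ : ℝ) :
    HasDerivAt (fun s => weakCodiff U u K (fun y => φ (y + (0, s))))
      (weakCodiff U u K (fun y => pderiv (Fin.last 3) φ (y + (0, τ)))) τ := by
  simp only [weakCodiff, pderiv_time_shift]
  refine HasDerivAt.fun_sum fun i _ => HasDerivAt.const_mul _ ?_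
  rw [pderiv_comm hφ.1]
  exact hasDerivAt_integral_time_shift (hu _) (hφ.pderiv i).1 (hφ.pderiv i).2.1 τ

/-- Translating the test function backwards by `s ≥ 0` keeps it admissible, because admissible
functions may be nonzero at and before `t₀`. The pairing `Φ s` then satisfies `ε Φ' + Φ = 0`, so
`exp (s / ε) * Φ s` is constant; it is zero once the support has left the cylinder. -/
theorem weakCodiff_eq_zero_of_evolution {Ωx : Set (Fin 3 → ℝ)} {t₀ T : ℝ}
    (ht : t₀ < T) {ε : ℝ} (hε : ε ≠ 0) {u : Pt → Form ℝ}
    (hu : ∀ I, IntegrableOn (fun y => u y I) (cylinder Ωx t₀ T)) {K : Finset (Fin 4)}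
    (h : ∀ φ, IsTest (Ωx ×ˢ Set.Iio T) φ →
      ε * weakCodiff (cylinder Ωx t₀ T) u K (pderiv (Fin.last 3) φ) +
        weakCodiff (cylinder Ωx t₀ T) u K φ = 0)
    {φ : Pt → ℝ} (hφ : IsTest (cylinder Ωx t₀ T) φ) :
    weakCodiff (cylinder Ωx t₀ T) u K φ = 0 := by
  set Φ : ℝ → ℝ := fun s => weakCodiff (cylinder Ωx t₀ T) u K (fun y => φ (y + (0, s))) with hΦ
  have hd := hasDerivAt_weakCodiff_time_shift hu hφ K
  have hode : ∀ τ, 0 ≤ τ →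
      HasDerivAt (fun s => Real.exp (s / ε) * Φ s) 0 τ := by
    intro τ hτ
    have h1 : HasDerivAt (fun s => Real.exp (s / ε)) (Real.exp (τ / ε) * (1 / ε)) τ :=
      ((hasDerivAt_id τ).div_const ε).exp
    refine (h1.mul (hd τ)).congr_deriv ?_
    have := h _ (hφ.time_shift (V := Ωx ×ˢ Set.Iio T) τ fun y hy => ⟨by simpa using hy.1, by
      have := hy.2.2
      simp only [Prod.snd_add] at this
      simp only [Set.mem_Iio]
      linarith⟩)
    rw [pderiv_time_shift] at this
    rw [show weakCodiff (cylinder Ωx t₀ T) u K (fun y => φ (y + (0, τ))) = -(ε * weakCodiff (cylinder Ωx t₀ T) u K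
      (fun y => pderiv (Fin.last 3) φ (y + (0, τ)))) by linarith]
    field_simp
    ring
  have hconst := constant_of_has_deriv_right_zero (a := 0) (b := T - t₀)
    (fun τ hτ => (hode τ hτ.1).continuousAt.continuousWithinAt)
    (fun τ hτ => (hode τ hτ.1).hasDerivWithinAt) (T - t₀) ⟨(sub_pos.2 ht).le, le_rfl⟩
  -- A shift by the full length `T - t₀` sends times after `t₀` past `T`, where `φ` vanishes.
  have hend : Φ (T - t₀) = 0 := by
    refine Finset.sum_eq_zero fun i _ => ?_
    rw [setIntegral_eq_zero_of_forall_eq_zero, mul_zero]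
    intro y hy
    simp only [pderiv_time_shift]
    rw [image_eq_zero_of_notMem_tsupport (f := pderiv i φ), mul_zero]
    intro hmem
    have h1 := ((hφ.pderiv i).2.2 hmem).2.2
    have h2 := hy.2.1
    simp only [Prod.snd_add] at h1
    linarith
  rw [hend] at hconst
  simp only [Real.exp_zero, zero_div, mul_zero, one_mul, hΦ] at hconst
  simpa [show ((0, 0) : Pt) = 0 from rfl] using hconst.symm

/-! ### Weak derivatives in one variable -/

/-- The primitive of `η` is constant after the support of `η`, generally nonzero, so it is truncated
between `T` and `T + 1`. Only functions free at `T` can serve here; for functions vanishing at `T`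
the integral of `η` would have to be zero. -/
theorem exists_primitive_test {t₀ T : ℝ} {η : ℝ → ℝ} (hη : IsTest (Set.Ioo t₀ T) η) :
    ∃ θ : ℝ → ℝ, IsTest (Set.Ioi t₀) θ ∧
      ∀ t ∈ Set.Ioo t₀ T, θ t = (∫ s in t₀..t, η s) ∧ deriv θ t = η t := by
  have hd : ∀ t, HasDerivAt (fun t => ∫ s in t₀..t, η s) (η t) t := fun t =>
    hη.1.continuous.integral_hasStrictDerivAt t₀ t |>.hasDerivAt
  have hsm : ContDiff ℝ ∞ (fun t => ∫ s in t₀..t, η s) := by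
    refine contDiff_infty_iff_deriv.2 ⟨fun t => (hd t).differentiableAt, ?_⟩
    rw [show deriv (fun t => ∫ s in t₀..t, η s) = η from funext fun t => (hd t).deriv]
    exact hη.1
  have hcut : ContDiff ℝ ∞ (fun t => Real.smoothTransition (T + 1 - t)) :=
    Real.smoothTransition.contDiff.comp (contDiff_const.sub contDiff_id)
  -- A whole neighbourhood of `t₀` is needed, since the closed support of the primitive must avoid
  -- `t₀` itself.
  have h0 : ∀ᶠ s in 𝓝 t₀, η s = 0 :=
    notMem_tsupport_iff_eventuallyEq.1 fun h => lt_irrefl t₀ (hη.2.2 h).1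
  obtain ⟨δ, hδ, hball⟩ := Metric.eventually_nhds_iff.1 h0
  have hzero : ∀ s < t₀ + δ, η s = 0 := by
    intro s hs
    by_cases hs' : t₀ < s
    · exact hball (by rw [Real.dist_eq, abs_of_pos] <;> linarith)
    · exact image_eq_zero_of_notMem_tsupport fun h => hs' (hη.2.2 h).1
  have hprim : ∀ t < t₀ + δ, ∫ s in t₀..t, η s = 0 := by
    intro t ht
    rw [intervalIntegral.integral_congr (g := fun _ => 0), intervalIntegral.integral_zero]
    intro s hs
    refine hzero s ?_
    have := hs.2
    rcases le_total t₀ t with h | h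
    · rw [max_eq_right h] at this
      linarith
    · rw [max_eq_left h] at this
      linarith
  refine ⟨fun t => (∫ s in t₀..t, η s) * Real.smoothTransition (T + 1 - t),
    ⟨hsm.mul hcut, ?_, ?_⟩, fun t ht => ⟨?_, ?_⟩⟩
  · refine HasCompactSupport.of_support_subset_isCompact (isCompact_Icc (a := t₀) (b := T + 1))
      fun t ht => ⟨?_, ?_⟩
    · by_contra h
      exact ht (by simp only [hprim t (by linarith), zero_mul])
    · by_contra h
      exact ht (by
        simp only [Real.smoothTransition.zero_of_nonpos (show T + 1 - t ≤ 0 by linarith), mul_zero])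
  · intro t ht
    by_contra h
    refine (notMem_tsupport_iff_eventuallyEq.2 ?_) ht
    have : t < t₀ + δ := by
      have : t ≤ t₀ := by simpa using h
      linarith
    filter_upwards [gt_mem_nhds this] with s hs
    simp only [hprim s hs, zero_mul, Pi.zero_apply]
  · simp only [Real.smoothTransition.one_of_one_le (show 1 ≤ T + 1 - t by linarith [ht.2]), mul_one]
  · refine HasDerivAt.deriv ((hd t).congr_of_eventuallyEq ?_)
    filter_upwards [gt_mem_nhds ht.2] with s hs
    simp only [Real.smoothTransition.one_of_one_le (show 1 ≤ T + 1 - s by linarith), mul_one]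

/-- The hypothesis says that `p` has weak derivative `m` and, because `θ` is free at `T`, that its
terminal value is zero. The continuous representative is therefore the primitive of `m` based at
`T`. -/
theorem exists_tendsto_zero_of_weak_deriv {t₀ T : ℝ} (ht : t₀ < T) {p m : ℝ → ℝ}
    (hp : IntegrableOn p (Set.Ioo t₀ T)) (hm : IntegrableOn m (Set.Ioo t₀ T))
    (h : ∀ θ : ℝ → ℝ, IsTest (Set.Ioi t₀) θ →
      (∫ t in Set.Ioo t₀ T, m t * θ t) + ∫ t in Set.Ioo t₀ T, p t * deriv θ t = 0) :
    ∃ q : ℝ → ℝ, (∀ᵐ t ∂(volume.restrict (Set.Ioo t₀ T)), q t = p t) ∧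
      Tendsto q (𝓝[<] T) (𝓝 0) := by
  have hmI : IntervalIntegrable m volume t₀ T :=
    (intervalIntegrable_iff_integrableOn_Ioo_of_le ht.le).2 hm
  set q : ℝ → ℝ := fun t => ∫ s in T..t, m s with hq
  have hac : AbsolutelyContinuousOnInterval q t₀ T :=
    hmI.absolutelyContinuousOnInterval_intervalIntegral Set.right_mem_uIcc
  have hqT : q T = 0 := intervalIntegral.integral_same
  have hqc : ContinuousOn q (Set.Icc t₀ T) := by
    have := hac.continuousOn
    rwa [Set.uIcc_of_le ht.le] at this
  refine ⟨q, ?_, ?_⟩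
  · have hqi : IntegrableOn q (Set.Ioo t₀ T) :=
      (hqc.integrableOn_Icc).mono_set Set.Ioo_subset_Icc_self
    have hae := IsOpen.ae_eq_zero_of_integral_contDiff_smul_eq_zero (μ := volume)
      (f := fun t => q t - p t) isOpen_Ioo (hqi.sub hp).locallyIntegrableOn ?_
    · rw [ae_restrict_iff' measurableSet_Ioo]
      filter_upwards [hae] with t h1 h2
      exact sub_eq_zero.1 (h1 h2)
    · intro η hη hηc hηs
      obtain ⟨θ, hθ, hθ'⟩ := exists_primitive_test ⟨hη, hηc, hηs⟩
      -- The untruncated primitive agrees with `θ` on the interval. As `m` is only integrable,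
      -- integration by parts is done for absolutely continuous functions; the boundary terms vanish
      -- because `q T = 0` and `θ₀ t₀ = 0`.
      set θ₀ : ℝ → ℝ := fun t => ∫ s in t₀..t, η s with hθ₀
      have hd : ∀ t, HasDerivAt θ₀ (η t) t := fun t =>
        hη.continuous.integral_hasStrictDerivAt t₀ t |>.hasDerivAt
      have hacθ : AbsolutelyContinuousOnInterval θ₀ t₀ T :=
        (hη.continuous.intervalIntegrable t₀ T).absolutelyContinuousOnInterval_intervalIntegral
          Set.left_mem_uIcc
      have hibp := hac.integral_mul_deriv_eq_deriv_mul hacθ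
      have hθ₀0 : θ₀ t₀ = 0 := intervalIntegral.integral_same
      rw [hqT, hθ₀0, zero_mul, mul_zero, sub_zero, zero_sub,
        intervalIntegral.integral_of_le ht.le, intervalIntegral.integral_of_le ht.le,
        integral_Ioc_eq_integral_Ioo, integral_Ioc_eq_integral_Ioo] at hibp
      have hdq : ∫ t in Set.Ioo t₀ T, deriv q t * θ₀ t = ∫ t in Set.Ioo t₀ T, m t * θ t := by
        refine setIntegral_congr_ae measurableSet_Ioo ?_
        filter_upwards [hmI.ae_hasDerivAt_integral] with t h1 h2
        have hmem : t ∈ Set.uIcc t₀ T := by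
          rw [Set.uIcc_of_le ht.le]
          exact Set.Ioo_subset_Icc_self h2
        rw [(h1 hmem T Set.right_mem_uIcc).deriv, (hθ' t h2).1]
      have hpθ : ∫ t in Set.Ioo t₀ T, p t * deriv θ t = ∫ t in Set.Ioo t₀ T, p t * η t :=
        setIntegral_congr_fun measurableSet_Ioo fun t h2 => by
          simp only [(hθ' t h2).2]
      have hh := h θ hθ
      simp only [fun t => (hd t).deriv] at hibp
      rw [hpθ, ← hdq] at hh
      obtain ⟨C, hC⟩ := hηc.exists_bound_of_continuous hη.continuous
      have hzero : ∀ t ∉ Set.Ioo t₀ T, η t • (q t - p t) = 0 := fun t ht' => by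
        rw [image_eq_zero_of_notMem_tsupport fun h => ht' (hηs h), zero_smul]
      rw [← setIntegral_eq_integral_of_forall_compl_eq_zero hzero]
      simp only [smul_eq_mul, mul_comm (η _), sub_mul]
      rw [integral_sub (hqi.mul_bdd hη.continuous.aestronglyMeasurable (ae_of_all _ hC))
        (hp.mul_bdd hη.continuous.aestronglyMeasurable (ae_of_all _ hC))]
      linarith
  · have := (hqc T (Set.right_mem_Icc.2 ht.le)).tendsto
    rw [hqT] at this
    refine this.mono_left (nhdsWithin_le_iff.2 ?_)
    exact mem_of_superset (Ioo_mem_nhdsLT ht) Set.Ioo_subset_Icc_self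

/-! ### From the variational problem to the equation -/

theorem MemHD.trace_eq_zero {k : ℕ} {Ωx : Set (Fin 3 → ℝ)} {t₀ T : ℝ} {v dv : Pt → Form ℝ}
    {g : (Fin 3 → ℝ) → Form ℝ} (h : MemHD k Ωx t₀ T v dv g) {I : Finset (Fin 4)}
    (hI : I.card ≠ k) : (fun x => g x I) =ᵐ[volume.restrict Ωx] 0 := by
  obtain ⟨vn, hvn, -, -, hg⟩ := h.approx
  have hIg := hg I
  have h0 : ∀ n x, tangential (vn n (x, T)) I = 0 := by
    intro n x
    simp [tangential, (hvn n).isForm _ I hI]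
  simp only [h0, zero_sub] at hIg
  have h0 := tendsto_nhds_unique tendsto_const_nhds hIg
  have := (eLpNorm_eq_zero_iff (h.trace_memL2 I).1.neg (by simp)).1 h0
  filter_upwards [this] with y hy
  simpa using hy

theorem weakCodiff_scaledFlux_of_card_ne {k : ℕ} {Ωx : Set (Fin 3 → ℝ)} (ho : IsOpen Ωx)
    {t₀ T : ℝ} {α : Pt → ℝ} {β : Pt → Fin 3 → ℝ} {ε : ℝ} {u du : Pt → Form ℝ}
    {g : (Fin 3 → ℝ) → Form ℝ} (h : MemHD k Ωx t₀ T u du g)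
    (hu : ∀ y ∈ cylinder Ωx t₀ T, IsForm k (u y)) {I : Finset (Fin 4)} (hI : I.card ≠ k)
    (φ : Pt → ℝ) : weakCodiff (cylinder Ωx t₀ T) (scaledFlux α β ε u du) I φ = 0 := by
  refine Finset.sum_eq_zero fun i hi => ?_
  have hc : (insert i I).card ≠ k + 1 := by
    rw [Finset.card_insert_of_notMem (Finset.mem_compl.1 hi)]
    omega
  rw [integral_eq_zero_of_ae, mul_zero]
  filter_upwards [h.deriv_eq_zero hc,
    ae_restrict_mem (isOpen_cylinder ho t₀ T).measurableSet] with y hy hyU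
  simp [scaledFlux_eq_zero (hu y hyU) hc hy]

theorem WeakEquation.forall {k : ℕ} {Ωx : Set (Fin 3 → ℝ)} (ho : IsOpen Ωx)
    {t₀ T : ℝ} {α : Pt → ℝ} {β : Pt → Fin 3 → ℝ} {ε : ℝ} {f u du : Pt → Form ℝ}
    {g : (Fin 3 → ℝ) → Form ℝ} (hW : WeakEquation k Ωx t₀ T (scaledFlux α β ε u du) f g)
    (h : MemHD k Ωx t₀ T u du g) (hu : ∀ y ∈ cylinder Ωx t₀ T, IsForm k (u y))
    (hf : ∀ y ∈ cylinder Ωx t₀ T, IsForm k (f y)) (I : Finset (Fin 4)) {φ : Pt → ℝ}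
    (hφ : IsTest (Ωx ×ˢ Set.Ioi t₀) φ) :
    weakCodiff (cylinder Ωx t₀ T) (scaledFlux α β ε u du) I φ +
      (if Fin.last 3 ∈ I then 0 else ∫ x in Ωx, g x I * φ (x, T)) =
    ∫ y in cylinder Ωx t₀ T, f y I * φ y := by
  by_cases hI : I.card = k
  · exact hW I hI φ hφ
  · have hR : ∫ y in cylinder Ωx t₀ T, f y I * φ y = 0 :=
      setIntegral_eq_zero_of_forall_eq_zero fun y hy => by rw [hf y hy I hI, zero_mul]
    have hL : ∫ x in Ωx, g x I * φ (x, T) = 0 := by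
      refine integral_eq_zero_of_ae ?_
      filter_upwards [h.trace_eq_zero hI] with x hx
      simp [hx]
    rw [weakCodiff_scaledFlux_of_card_ne ho h hu hI, hR, hL, ite_self, add_zero]

/-! ### The natural boundary condition at the terminal time -/

theorem contractT_hodge_hodgeScaled (a ε : ℝ) (w : Form ℝ) {I : Finset (Fin 4)}
    (hI : Fin.last 3 ∉ I) :
    contractT (hodge (hodgeScaled a ε w)) I =
      ((sgn (insert (Fin.last 3) I)ᶜ (insert (Fin.last 3) I) : ℝ) *
        sgn (insert (Fin.last 3) I) (insert (Fin.last 3) I)ᶜ * ε) *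
        w (insert (Fin.last 3) I) := by
  simp only [contractT, if_neg hI, hodgeScaled, hodge, compl_compl, zsmul_eq_mul,
    if_pos (Finset.mem_insert_self (Fin.last 3) I)]
  ring

/-- On each coefficient without `dt`, the operator `* *_α` followed by the contraction is
multiplication by a nonzero constant, `±ε`; the variable `α` does not enter. -/
theorem normalTraceZero_iff {Ωx : Set (Fin 3 → ℝ)} {t₀ T : ℝ} {α : Pt → ℝ} {ε : ℝ} (hε : ε ≠ 0)
    {du : Pt → Form ℝ} :
    NormalTraceZero Ωx t₀ T (fun y => hodge (hodgeScaled (α y) ε (du y))) ↔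
      ∀ I : Finset (Fin 4), Fin.last 3 ∉ I → ∀ χ : (Fin 3 → ℝ) → ℝ, IsTest Ωx χ →
        ∃ h : ℝ → ℝ, (∀ᵐ t ∂(volume.restrict (Set.Ioo t₀ T)),
          h t = ∫ x in Ωx, du (x, t) (insert (Fin.last 3) I) * χ x) ∧
          Tendsto h (𝓝[<] T) (𝓝 0) := by
  have hint : ∀ I : Finset (Fin 4), Fin.last 3 ∉ I → ∃ c : ℝ, c ≠ 0 ∧
      ∀ (χ : (Fin 3 → ℝ) → ℝ) (t : ℝ),
      (∫ x in Ωx, contractT (hodge (hodgeScaled (α (x, t)) ε (du (x, t)))) I * χ x) =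
        c * ∫ x in Ωx, du (x, t) (insert (Fin.last 3) I) * χ x := by
    intro I hI
    have hs : ∀ A B, (sgn A B : ℝ) ≠ 0 := fun A B h0 => by
      simpa [h0] using sgn_cast_mul_self A B
    refine ⟨_, mul_ne_zero (mul_ne_zero (hs (insert (Fin.last 3) I)ᶜ (insert (Fin.last 3) I))
      (hs (insert (Fin.last 3) I) (insert (Fin.last 3) I)ᶜ)) hε, fun χ t => ?_⟩
    simp only [contractT_hodge_hodgeScaled _ _ _ hI]
    rw [← integral_const_mul]
    simp only [mul_assoc]
  constructor
  · intro h I hI χ hχ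
    obtain ⟨q, hq, hq0⟩ := h I χ hχ
    obtain ⟨c, hc, hcI⟩ := hint I hI
    refine ⟨fun t => c⁻¹ * q t, ?_, by simpa using hq0.const_mul c⁻¹⟩
    filter_upwards [hq] with t ht
    rw [ht, hcI, inv_mul_cancel_left₀ hc]
  · intro h I χ hχ
    by_cases hI : Fin.last 3 ∈ I
    · refine ⟨fun _ => 0, ae_of_all _ fun t => ?_, tendsto_const_nhds⟩
      simp only [contractT, if_pos hI, zero_mul, integral_zero]
    · obtain ⟨q, hq, hq0⟩ := h I hI χ hχ
      obtain ⟨c, hc, hcI⟩ := hint I hI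
      refine ⟨fun t => c * q t, ?_, by simpa using hq0.const_mul c⟩
      filter_upwards [hq] with t ht
      rw [ht, hcI]

theorem weakCodiff_split {k : ℕ} {Ωx : Set (Fin 3 → ℝ)} (ho : IsOpen Ωx)
    (hb : Bornology.IsBounded Ωx) {t₀ T : ℝ} {α : Pt → ℝ} {β : Pt → Fin 3 → ℝ}
    {ε : ℝ} (hε : ε ≠ 0) {u du : Pt → Form ℝ} {g : (Fin 3 → ℝ) → Form ℝ}
    (h : MemHD k Ωx t₀ T u du g) (hu : ∀ y ∈ cylinder Ωx t₀ T, NoDt (u y))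
    {I : Finset (Fin 4)} (hI : Fin.last 3 ∉ I) {φ : Pt → ℝ} (hφ : ContDiff ℝ ∞ φ) :
    weakCodiff (cylinder Ωx t₀ T) (scaledFlux α β ε u du) I φ =
      (∑ i ∈ (insert (Fin.last 3) I)ᶜ, (sgn {i} I : ℝ) *
        ∫ y in cylinder Ωx t₀ T, scaledFlux α β ε u du y (insert i I) * pderiv i φ y) +
      ((-1) ^ I.card * (ε * ∫ y in cylinder Ωx t₀ T,
          du y (insert (Fin.last 3) I) * pderiv (Fin.last 3) φ y) -
        ∫ y in cylinder Ωx t₀ T, u y I * pderiv (Fin.last 3) φ y) := by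
  have hm {χ : Pt → ℝ} (hχ : ContDiff ℝ ∞ χ) : MemLp χ 2 (volume.restrict (cylinder Ωx t₀ T)) :=
    memLp_restrict_of_continuous (isBounded_cylinder hb t₀ T)
      (isOpen_cylinder ho t₀ T).measurableSet hχ.continuous
  have hIc : Iᶜ = insert (Fin.last 3) (insert (Fin.last 3) I)ᶜ := by
    ext i
    by_cases hi : i = Fin.last 3 <;> simp_all
  rw [weakCodiff, hIc, Finset.sum_insert (by simp), add_comm]
  congr 1
  rw [setIntegral_congr_fun (isOpen_cylinder ho t₀ T).measurableSet
      (g := fun y => ε * (du y (insert (Fin.last 3) I) * pderiv (Fin.last 3) φ y) -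
        (-1) ^ I.card * (u y I * pderiv (Fin.last 3) φ y))
      (fun y hy => by
        simp only [scaledFlux_time hε (hu y hy) hI]
        ring),
    integral_sub
      ((integrable_mul_of_memLp (h.deriv_memL2 _) (hm (contDiff_pderiv hφ _))).const_mul _)
      ((integrable_mul_of_memLp (h.memL2 _) (hm (contDiff_pderiv hφ _))).const_mul _),
    integral_const_mul, integral_const_mul, sgn_last I hI]
  have hs : ((-1 : ℝ) ^ I.card) * (-1) ^ I.card = 1 := by
    rw [← mul_pow]; simp
  rw [Int.cast_pow, Int.cast_neg, Int.cast_one]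
  linear_combination
    (-∫ y in cylinder Ωx t₀ T, u y I * pderiv (Fin.last 3) φ y) * hs

theorem IsTest.tensor {Ωx : Set (Fin 3 → ℝ)} {I : Set ℝ} {χ : (Fin 3 → ℝ) → ℝ} {θ : ℝ → ℝ}
    (hχ : IsTest Ωx χ) (hθ : IsTest I θ) : IsTest (Ωx ×ˢ I) (fun y : Pt => χ y.1 * θ y.2) := by
  have hs : tsupport (fun y : Pt => χ y.1 * θ y.2) ⊆ tsupport χ ×ˢ tsupport θ := by
    refine closure_minimal (fun y hy => ⟨subset_tsupport _ ?_, subset_tsupport _ ?_⟩)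
      ((isClosed_tsupport _).prod (isClosed_tsupport _))
    · exact left_ne_zero_of_mul hy
    · exact right_ne_zero_of_mul hy
  exact ⟨(hχ.1.comp contDiff_fst).mul (hθ.1.comp contDiff_snd),
    (hχ.2.1.isCompact.prod hθ.2.1.isCompact).of_isClosed_subset (isClosed_tsupport _) hs,
    hs.trans (Set.prod_mono hχ.2.2 hθ.2.2)⟩

theorem setIntegral_cylinder_mul_comp_snd {Ωx : Set (Fin 3 → ℝ)} {t₀ T : ℝ} {F : Pt → ℝ}
    (hF : IntegrableOn F (cylinder Ωx t₀ T)) {θ : ℝ → ℝ} (hθ : Continuous θ) :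
    ∫ y in cylinder Ωx t₀ T, F y * θ y.2 =
      ∫ t in Set.Ioo t₀ T, (∫ x in Ωx, F (x, t)) * θ t := by
  obtain ⟨C, -, hC⟩ := exists_bound_of_isBounded (Metric.isBounded_Ioo t₀ T) hθ
  rw [setIntegral_cylinder_symm]
  · simp only [integral_mul_const]
  · refine hF.mul_bdd (c := C) (hθ.comp continuous_snd).aestronglyMeasurable ?_
    rw [volume_restrict_cylinder]
    have : ∀ᵐ t ∂(volume.restrict (Set.Ioo t₀ T)), ‖θ t‖ ≤ C :=
      (ae_restrict_iff' measurableSet_Ioo).2 (ae_of_all _ hC)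
    exact Measure.quasiMeasurePreserving_snd.ae this

theorem integrableOn_slice_integral {Ωx : Set (Fin 3 → ℝ)} {t₀ T : ℝ} {F : Pt → ℝ}
    (hF : IntegrableOn F (cylinder Ωx t₀ T)) :
    IntegrableOn (fun t => ∫ x in Ωx, F (x, t)) (Set.Ioo t₀ T) := by
  rw [IntegrableOn, volume_restrict_cylinder] at hF
  exact hF.integral_prod_right

/-- With test functions `χ(x) θ(t)` and `P` the `dt` part of `d u` times `χ`, Green's formula
removes the trace and turns the equation into a weak ODE in time for the slice integrals of `P`. As
`θ` is free at `T`, it also contains the terminal value. -/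
theorem exists_slice_tendsto_zero {k : ℕ} {Ωx : Set (Fin 3 → ℝ)} (ho : IsOpen Ωx)
    (hb : Bornology.IsBounded Ωx) {t₀ T : ℝ} (ht : t₀ < T) {α : Pt → ℝ} {β : Pt → Fin 3 → ℝ}
    {ε : ℝ} (hε : ε ≠ 0) {f u du : Pt → Form ℝ} {g : (Fin 3 → ℝ) → Form ℝ}
    (h : MemHD k Ωx t₀ T u du g) (hu : ∀ y ∈ cylinder Ωx t₀ T, NoDt (u y))
    (hS : L2Form (cylinder Ωx t₀ T) (scaledFlux α β ε u du))
    (hf : L2Form (cylinder Ωx t₀ T) f) {I : Finset (Fin 4)} (hI : Fin.last 3 ∉ I)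
    (hW : ∀ φ, IsTest (Ωx ×ˢ Set.Ioi t₀) φ →
      weakCodiff (cylinder Ωx t₀ T) (scaledFlux α β ε u du) I φ +
        (∫ x in Ωx, g x I * φ (x, T)) = ∫ y in cylinder Ωx t₀ T, f y I * φ y)
    {χ : (Fin 3 → ℝ) → ℝ} (hχ : IsTest Ωx χ) :
    ∃ q : ℝ → ℝ, (∀ᵐ t ∂(volume.restrict (Set.Ioo t₀ T)),
      q t = ∫ x in Ωx, du (x, t) (insert (Fin.last 3) I) * χ x) ∧
      Tendsto q (𝓝[<] T) (𝓝 0) := by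
  have hm {χ : Pt → ℝ} (hχ : Continuous χ) : MemLp χ 2 (volume.restrict (cylinder Ωx t₀ T)) :=
    memLp_restrict_of_continuous (isBounded_cylinder hb t₀ T)
      (isOpen_cylinder ho t₀ T).measurableSet hχ
  have hX : ContDiff ℝ ∞ (fun y : Pt => χ y.1) := hχ.1.comp contDiff_fst
  have hint {F ψ : Pt → ℝ} (hF : MemLp F 2 (volume.restrict (cylinder Ωx t₀ T)))
      (hψ : Continuous ψ) : IntegrableOn (fun y => F y * ψ y) (cylinder Ωx t₀ T) :=
    integrable_mul_of_memLp hF (hm hψ)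
  set P : Pt → ℝ := fun y => du y (insert (Fin.last 3) I) * χ y.1 with hPdef
  have hP : IntegrableOn P (cylinder Ωx t₀ T) := hint (h.deriv_memL2 _) hX.continuous
  -- All terms of the tested equation except the one in which `ε P` meets `deriv θ`. The summand
  -- with `P` itself is what Green's formula makes of the trace and the convection in time.
  set G : Pt → ℝ := fun y => (∑ i ∈ (insert (Fin.last 3) I)ᶜ, (sgn {i} I : ℝ) *
    (scaledFlux α β ε u du y (insert i I) * pderiv i (fun z => χ z.1) y)) +
      ((-1) ^ I.card * P y - f y I * χ y.1) with hGdef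
  have hG1 : ∀ i ∈ (insert (Fin.last 3) I)ᶜ, IntegrableOn (fun y => (sgn {i} I : ℝ) *
      (scaledFlux α β ε u du y (insert i I) * pderiv i (fun z => χ z.1) y)) (cylinder Ωx t₀ T) :=
    fun i _ => (hint (hS _) (contDiff_pderiv hX i).continuous).const_mul _
  have hG : IntegrableOn G (cylinder Ωx t₀ T) :=
    (integrable_finsetSum _ hG1).add ((hP.const_mul _).sub (hint (hf I) hX.continuous))
  have hc : ((-1 : ℝ) ^ I.card) * (-1) ^ I.card = 1 := by
    rw [← mul_pow]; simp
  refine exists_tendsto_zero_of_weak_deriv ht (m := fun t =>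
    (ε⁻¹ * (-1) ^ I.card) * ∫ x in Ωx, G (x, t)) (integrableOn_slice_integral hP)
    ((integrableOn_slice_integral hG).const_mul _) fun θ hθ => ?_
  have hθ' : ContDiff ℝ ∞ (deriv θ) := (contDiff_infty_iff_deriv.1 hθ.1).2
  simp only [mul_assoc (ε⁻¹ * (-1) ^ I.card)]
  rw [integral_const_mul, ← setIntegral_cylinder_mul_comp_snd hG hθ.1.continuous,
    ← setIntegral_cylinder_mul_comp_snd hP hθ'.continuous]
  have hφ := hχ.tensor hθ
  have hΘ : ContDiff ℝ ∞ (fun y : Pt => θ y.2) := hθ.1.comp contDiff_snd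
  have hpt : ∀ y : Pt, pderiv (Fin.last 3) (fun y : Pt => χ y.1 * θ y.2) y =
      χ y.1 * deriv θ y.2 := fun y => by
    rw [pderiv_mul hX hΘ, pderiv_last_comp_fst _ hχ.1, pderiv_last_comp_snd _ hθ.1, zero_mul,
      add_zero]
  have hpx : ∀ i ∈ (insert (Fin.last 3) I)ᶜ, ∀ y : Pt,
      pderiv i (fun y : Pt => χ y.1 * θ y.2) y =
        pderiv i (fun z : Pt => χ z.1) y * θ y.2 := fun i hi y => by
    have hne : i ≠ Fin.last 3 := fun e =>
      Finset.mem_compl.1 hi (e ▸ Finset.mem_insert_self _ _)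
    rw [pderiv_mul hX hΘ, pderiv_castSucc_comp_snd _ hθ.1 hne, mul_zero, zero_add]
  have hGθ : ∫ y in cylinder Ωx t₀ T, G y * θ y.2 =
      (∑ i ∈ (insert (Fin.last 3) I)ᶜ, (sgn {i} I : ℝ) *
        ∫ y in cylinder Ωx t₀ T, scaledFlux α β ε u du y (insert i I) *
          pderiv i (fun y : Pt => χ y.1 * θ y.2) y) +
      ((-1) ^ I.card * (∫ y in cylinder Ωx t₀ T,
        du y (insert (Fin.last 3) I) * (χ y.1 * θ y.2)) -
        ∫ y in cylinder Ωx t₀ T, f y I * (χ y.1 * θ y.2)) := by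
    rw [← integral_const_mul, ← integral_sub, Finset.sum_congr rfl fun i _ =>
      (integral_const_mul (sgn {i} I : ℝ) _).symm, ← integral_finsetSum, ← integral_add]
    · refine integral_congr_ae (ae_of_all _ fun y => ?_)
      simp only [hGdef, hPdef, add_mul, Finset.sum_mul]
      congr 1
      · refine Finset.sum_congr rfl fun i hi => ?_
        rw [hpx i hi]
        ring
      · ring
    · exact integrable_finsetSum _ fun i _ =>
        (hint (hS _) (contDiff_pderiv hφ.1 i).continuous).const_mul _
    · exact ((hint (h.deriv_memL2 _) hφ.1.continuous).const_mul _).sub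
        (hint (hf I) hφ.1.continuous)
    · exact fun i _ => (hint (hS _) (contDiff_pderiv hφ.1 i).continuous).const_mul _
    · exact (hint (h.deriv_memL2 _) hφ.1.continuous).const_mul _
    · exact hint (hf I) hφ.1.continuous
  have hw := hW _ hφ
  have hgreen := h.integral_time_deriv_mul ho hb ht hu hI hφ.1
  rw [weakCodiff_split ho hb hε h hu hI hφ.1] at hw
  simp only [hpt] at hw hgreen
  rw [hGθ]
  simp only [hPdef, mul_assoc]
  have hA : (∑ i ∈ (insert (Fin.last 3) I)ᶜ, (sgn {i} I : ℝ) *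
        ∫ y in cylinder Ωx t₀ T, scaledFlux α β ε u du y (insert i I) *
          pderiv i (fun y : Pt => χ y.1 * θ y.2) y) +
      ((-1) ^ I.card * (∫ y in cylinder Ωx t₀ T,
        du y (insert (Fin.last 3) I) * (χ y.1 * θ y.2)) -
        ∫ y in cylinder Ωx t₀ T, f y I * (χ y.1 * θ y.2)) =
      -((-1) ^ I.card * (ε * ∫ y in cylinder Ωx t₀ T,
          du y (insert (Fin.last 3) I) * (χ y.1 * deriv θ y.2))) := by
    linarith
  rw [hA]
  generalize (∫ y in cylinder Ωx t₀ T,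
    du y (insert (Fin.last 3) I) * (χ y.1 * deriv θ y.2)) = X
  field_simp
  linear_combination (-X) * hc

theorem weakCodiff_eq_zero_of_noDt {U : Set Pt} {u : Pt → Form ℝ} (hu : ∀ y ∈ U, NoDt (u y))
    {K : Finset (Fin 4)} (hK : Fin.last 3 ∈ K) (φ : Pt → ℝ) : weakCodiff U u K φ = 0 := by
  refine Finset.sum_eq_zero fun i _ => ?_
  rw [setIntegral_eq_zero_of_forall_eq_zero, mul_zero]
  intro y hy
  rw [hu y hy _ (Finset.mem_insert_of_mem hK), zero_mul]

theorem distD_hodge_eq_zero_iff {U : Set Pt} (hU : Bornology.IsBounded U) (hm : MeasurableSet U)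
    {u : Pt → Form ℝ} (hu : L2Form U u) {φ : Pt → ℝ} (hφ : ContDiff ℝ ∞ φ)
    (J : Finset (Fin 4)) :
    distD U (fun y => hodge (u y)) J φ = 0 ↔ weakCodiff U u Jᶜ φ = 0 := by
  have h := hodge_distD_hodge hU hm hu hφ Jᶜ
  rw [compl_compl] at h
  have hs : (sgn J Jᶜ : ℝ) ≠ 0 := fun h0 => by simpa [h0] using sgn_cast_mul_self J Jᶜ
  constructor
  · intro h0
    rw [h0, mul_zero] at h
    linarith
  · intro h0
    rw [h0, neg_zero] at h
    exact (mul_eq_zero.1 h).resolve_left hs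

theorem unifiedEquation_and_normalTraceZero {k : ℕ} {Ωx : Set (Fin 3 → ℝ)} (ho : IsOpen Ωx)
    (hb : Bornology.IsBounded Ωx) {t₀ T : ℝ} (ht : t₀ < T) {α : Pt → ℝ} {β : Pt → Fin 3 → ℝ}
    {ε : ℝ} (hε : ε ≠ 0) {f u du : Pt → Form ℝ} {g : (Fin 3 → ℝ) → Form ℝ}
    (h : MemHD k Ωx t₀ T u du g)
    (hu : ∀ y ∈ cylinder Ωx t₀ T, IsForm k (u y) ∧ NoDt (u y))
    (hS : L2Form (cylinder Ωx t₀ T) (scaledFlux α β ε u du))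
    (hf : L2Form (cylinder Ωx t₀ T) f)
    (hf' : ∀ y ∈ cylinder Ωx t₀ T, IsForm k (f y) ∧ NoDt (f y))
    (hW : WeakEquation k Ωx t₀ T (scaledFlux α β ε u du) f g) :
    UnifiedEquation (cylinder Ωx t₀ T) α β ε u du f ∧
      NormalTraceZero Ωx t₀ T (fun y => hodge (hodgeScaled (α y) ε (du y))) := by
  have hUb := isBounded_cylinder hb t₀ T
  have hUm := (isOpen_cylinder ho t₀ T).measurableSet
  have := Fact.mk hUb
  have hu2 : ∀ y ∈ cylinder Ωx t₀ T, NoDt (u y) := fun y hy => (hu y hy).2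
  have hWall := fun I (φ : Pt → ℝ) (hφ : IsTest (Ωx ×ˢ Set.Ioi t₀) φ) =>
    hW.forall ho h (fun y hy => (hu y hy).1) (fun y hy => (hf' y hy).1) I hφ
  have hWin : ∀ I φ, IsTest (cylinder Ωx t₀ T) φ →
      weakCodiff (cylinder Ωx t₀ T) (scaledFlux α β ε u du) I φ =
        ∫ y in cylinder Ωx t₀ T, f y I * φ y := by
    intro I φ hφ
    have hz : ∀ x, φ (x, T) = 0 := fun x =>
      image_eq_zero_of_notMem_tsupport fun hx => lt_irrefl T (hφ.2.2 hx).2.2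
    have := hWall I φ ⟨hφ.1, hφ.2.1, hφ.2.2.trans (Set.prod_mono_right Set.Ioo_subset_Ioi_self)⟩
    simpa [hz] using this
  have hfz : ∀ I, Fin.last 3 ∈ I → ∀ φ : Pt → ℝ, ∫ y in cylinder Ωx t₀ T, f y I * φ y = 0 :=
    fun I hI φ => setIntegral_eq_zero_of_forall_eq_zero fun y hy => by
      rw [(hf' y hy).2 I hI, zero_mul]
  -- The divergence of `u` vanishes: the coefficients with `dt` give its evolution equation, with
  -- test functions that need not vanish near `t₀`.
  have hco : ∀ K φ, IsTest (cylinder Ωx t₀ T) φ → weakCodiff (cylinder Ωx t₀ T) u K φ = 0 := by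
    intro K φ hφ
    by_cases hK : Fin.last 3 ∈ K
    · exact weakCodiff_eq_zero_of_noDt hu2 hK φ
    · refine weakCodiff_eq_zero_of_evolution ht hε (fun I => (h.memL2 I).integrable (by simp))
        (fun ψ hψ => ?_) hφ
      have h0 := weakCodiff_eq_zero_of_cylinder ho hb hS (Finset.mem_insert_self (Fin.last 3) K)
        (fun φ hφ => (hWin _ φ hφ).trans (hfz _ (Finset.mem_insert_self _ _) φ))
        (φ := ψ) ⟨hψ.1, hψ.2.1, hψ.2.2.trans (Set.prod_mono_right (Set.subset_univ _))⟩
      rw [weakCodiff_time ho hb ht hε h hu2 hK hψ.1 fun i x =>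
        image_eq_zero_of_notMem_tsupport fun hx => lt_irrefl T ((hψ.pderiv i).2.2 hx).2] at h0
      exact (mul_eq_zero.1 h0).resolve_left (pow_ne_zero _ (by norm_num))
  -- Since `d * u = 0`, zero serves as the weak derivative, and `d δ_{α1} u` contributes nothing.
  refine ⟨⟨fun y => -hodgeScaled (α y) ε 0, ⟨fun _ _ => 0, fun I => MemLp.zero, ?_, rfl⟩, ?_⟩,
    (normalTraceZero_iff hε).2 fun I hI χ hχ => ?_⟩
  · intro J φ hφ
    rw [(distD_hodge_eq_zero_iff hUb hUm h.memL2 hφ.1 J).2 (hco _ φ hφ)]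
    simp [toDist]
  · intro I φ hφ
    rw [Pi.add_apply, Pi.add_apply, codiffOneAlpha_flux hUb hUm hS hφ.1, hWin I φ hφ]
    simp [distD, hodgeScaled, hodge, toDist]
  · refine exists_slice_tendsto_zero ho hb ht hε h hu2 hS hf hI (fun φ hφ => ?_) hχ
    have := hWall I φ hφ
    rwa [if_neg hI] at this

/-! ### From the equation to the variational problem -/

theorem ae_eq_zero_of_toDist {U : Set Pt} (hU : IsOpen U) {w : Pt → Form ℝ}
    {J : Finset (Fin 4)} (hw : IntegrableOn (fun y => w y J) U)
    (h : ∀ φ, IsTest U φ → toDist U w J φ = 0) :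
    ∀ᵐ y ∂(volume.restrict U), w y J = 0 := by
  have := hU.ae_eq_zero_of_integral_contDiff_smul_eq_zero (μ := volume)
    (f := fun y => w y J) hw.locallyIntegrableOn fun φ h1 h2 h3 => ?_
  · exact (ae_restrict_iff' hU.measurableSet).2 this
  · rw [← setIntegral_eq_integral_of_forall_compl_eq_zero (s := U) fun y hy => by
      rw [image_eq_zero_of_notMem_tsupport fun h => hy (h3 h), zero_smul]]
    simpa only [toDist, smul_eq_mul, mul_comm] using h φ ⟨h1, h2, h3⟩

/-- In the coefficients with `dt`, the term `d δ_{α1} u` is the exact opposite of the `ε ∂_t` part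
of the flux term. What remains is `d * u = 0`, with no ODE to solve, and then `d δ_{α1} u`
disappears from every coefficient. -/
theorem UnifiedEquation.weakCodiff_eq {k : ℕ} {Ωx : Set (Fin 3 → ℝ)} (ho : IsOpen Ωx)
    (hb : Bornology.IsBounded Ωx) {t₀ T : ℝ} (ht : t₀ < T) {α : Pt → ℝ} {β : Pt → Fin 3 → ℝ}
    {ε : ℝ} (hε : ε ≠ 0) {f u du : Pt → Form ℝ} {g : (Fin 3 → ℝ) → Form ℝ}
    (h : MemHD k Ωx t₀ T u du g) (hu : ∀ y ∈ cylinder Ωx t₀ T, NoDt (u y))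
    (hS : L2Form (cylinder Ωx t₀ T) (scaledFlux α β ε u du))
    (hf : ∀ y ∈ cylinder Ωx t₀ T, NoDt (f y))
    (hE : UnifiedEquation (cylinder Ωx t₀ T) α β ε u du f) (I : Finset (Fin 4)) {φ : Pt → ℝ}
    (hφ : IsTest (cylinder Ωx t₀ T) φ) :
    weakCodiff (cylinder Ωx t₀ T) (scaledFlux α β ε u du) I φ =
      ∫ y in cylinder Ωx t₀ T, f y I * φ y := by
  have hUb := isBounded_cylinder hb t₀ T
  have hUo := isOpen_cylinder ho t₀ T
  have hUm := hUo.measurableSet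
  have := Fact.mk hUb
  obtain ⟨s, ⟨E, hE2, hEw, rfl⟩, heq⟩ := hE
  have heq' : ∀ I φ, IsTest (cylinder Ωx t₀ T) φ →
      weakCodiff (cylinder Ωx t₀ T) (scaledFlux α β ε u du) I φ +
        distD (cylinder Ωx t₀ T) (fun y => -hodgeScaled (α y) ε (E y)) I φ =
      ∫ y in cylinder Ωx t₀ T, f y I * φ y := by
    intro I φ hφ
    rw [← codiffOneAlpha_flux hUb hUm hS hφ.1]
    exact heq I φ hφ
  have hEzero : ∀ J, (∀ φ, IsTest (cylinder Ωx t₀ T) φ →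
      weakCodiff (cylinder Ωx t₀ T) u Jᶜ φ = 0) →
      ∀ᵐ y ∂(volume.restrict (cylinder Ωx t₀ T)), E y J = 0 := by
    intro J hJ
    refine ae_eq_zero_of_toDist hUo ((hE2 J).integrable (by simp)) fun φ hφ => ?_
    rw [hEw J φ hφ]
    exact (distD_hodge_eq_zero_iff hUb hUm h.memL2 hφ.1 J).2 (hJ φ hφ)
  have hsE : ∀ y K, (-hodgeScaled (α y) ε (E y)) K =
      -((sgn Kᶜ K : ℝ) * ((if Fin.last 3 ∈ Kᶜ then ε else α y) * E y Kᶜ)) := by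
    intro y K
    simp only [Pi.neg_apply, hodgeScaled, hodge, zsmul_eq_mul]
  have hco : ∀ K φ, IsTest (cylinder Ωx t₀ T) φ → weakCodiff (cylinder Ωx t₀ T) u K φ = 0 := by
    intro K φ hφ
    by_cases hK : Fin.last 3 ∈ K
    · exact weakCodiff_eq_zero_of_noDt hu hK φ
    have hd : distD (cylinder Ωx t₀ T) (fun y => -hodgeScaled (α y) ε (E y))
        (insert (Fin.last 3) K) φ =
        -((-1) ^ K.card * (ε * weakCodiff (cylinder Ωx t₀ T) u K (pderiv (Fin.last 3) φ))) := by
      -- Spatial directions contribute nothing to `d δ_{α1} u` here: they involve codifferentials of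
      -- `u` whose index still contains `dt`, and these vanish.
      have hzero : ∀ᵐ y ∂(volume.restrict (cylinder Ωx t₀ T)), ∀ i ∈ K,
          E y ((insert (Fin.last 3) K).erase i)ᶜ = 0 := by
        refine ae_all_iff.2 fun i => ?_
        by_cases hi : i ∈ K
        · refine (hEzero _ fun φ _ => weakCodiff_eq_zero_of_noDt hu ?_ φ).mono fun y hy _ => hy
          rw [compl_compl]
          exact Finset.mem_erase.2 ⟨fun e => hK (e ▸ hi), Finset.mem_insert_self _ _⟩
        · exact ae_of_all _ fun y hi' => absurd hi' hi
      have hint : ∫ y in cylinder Ωx t₀ T, ∑ i ∈ insert (Fin.last 3) K,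
          (sgn {i} ((insert (Fin.last 3) K).erase i) : ℝ) *
            (-hodgeScaled (α y) ε (E y)) ((insert (Fin.last 3) K).erase i) * pderiv i φ y =
          ∫ y in cylinder Ωx t₀ T, -((-1) ^ K.card * (ε * (sgn Kᶜ K : ℝ))) *
            (E y Kᶜ * pderiv (Fin.last 3) φ y) := by
        refine integral_congr_ae ?_
        filter_upwards [hzero] with y hy
        rw [Finset.sum_insert hK, Finset.sum_eq_zero, add_zero, Finset.erase_insert hK, hsE,
          if_pos (Finset.mem_compl.2 hK), sgn_last K hK, Int.cast_pow, Int.cast_neg, Int.cast_one]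
        · ring
        · intro i hi
          rw [hsE, hy i hi]
          ring
      rw [distD, hint, integral_const_mul]
      have h1 : ∫ y in cylinder Ωx t₀ T, E y Kᶜ * pderiv (Fin.last 3) φ y =
          distD (cylinder Ωx t₀ T) (fun y => hodge (u y)) Kᶜ (pderiv (Fin.last 3) φ) :=
        hEw Kᶜ _ (hφ.pderiv _)
      have h2 := hodge_distD_hodge hUb hUm h.memL2 (contDiff_pderiv hφ.1 (Fin.last 3)) K
      rw [h1]
      linear_combination (-1) ^ K.card * ε * h2
    have h0 := heq' (insert (Fin.last 3) K) φ hφ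
    rw [hd, weakCodiff_time ho hb ht hε h hu hK hφ.1 fun i x =>
        image_eq_zero_of_notMem_tsupport fun hx => lt_irrefl T ((hφ.pderiv i).2.2 hx).2.2,
      setIntegral_eq_zero_of_forall_eq_zero fun y hy => by
        rw [hf y hy _ (Finset.mem_insert_self _ _), zero_mul]] at h0
    have h1 : (-1 : ℝ) ^ K.card * weakCodiff (cylinder Ωx t₀ T) u K φ = 0 := by
      linear_combination h0
    exact (mul_eq_zero.1 h1).resolve_left (pow_ne_zero _ (by norm_num))
  have hEall : ∀ᵐ y ∂(volume.restrict (cylinder Ωx t₀ T)), ∀ J, E y J = 0 :=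
    ae_all_iff.2 fun J => hEzero J fun φ hφ => hco _ φ hφ
  have hd0 : distD (cylinder Ωx t₀ T) (fun y => -hodgeScaled (α y) ε (E y)) I φ = 0 := by
    rw [distD, integral_eq_zero_of_ae, neg_zero]
    filter_upwards [hEall] with y hy
    refine Finset.sum_eq_zero fun i _ => ?_
    rw [hsE, hy]
    ring
  have := heq' I φ hφ
  rwa [hd0, add_zero] at this

/-! ### Derivatives of time cutoffs concentrating at the terminal time -/

theorem exists_bound_deriv_smoothTransition :
    ∃ C, 0 ≤ C ∧ ∀ x, |deriv Real.smoothTransition x| ≤ C := by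
  have hc : Continuous (deriv Real.smoothTransition) :=
    (contDiff_infty_iff_deriv.1 Real.smoothTransition.contDiff).2.continuous
  obtain ⟨C, hC0, hC⟩ := exists_bound_of_isBounded (Metric.isBounded_Icc (0 : ℝ) 1) hc
  refine ⟨C, hC0, fun x => ?_⟩
  by_cases hx : x ∈ Set.Icc (0 : ℝ) 1
  · exact hC x hx
  · suffices deriv Real.smoothTransition x = 0 by rw [this, abs_zero]; exact hC0
    rcases lt_or_ge x 0 with h | h
    · have : Real.smoothTransition =ᶠ[𝓝 x] fun _ => 0 := by
        filter_upwards [gt_mem_nhds h] with s hs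
        exact Real.smoothTransition.zero_of_nonpos hs.le
      rw [this.deriv_eq, deriv_const]
    · have hx1 : 1 < x := by
        by_contra h1
        exact hx ⟨h, not_lt.1 h1⟩
      have : Real.smoothTransition =ᶠ[𝓝 x] fun _ => 1 := by
        filter_upwards [lt_mem_nhds hx1] with s hs
        exact Real.smoothTransition.one_of_one_le hs.le
      rw [this.deriv_eq, deriv_const]

/-- The derivative of the cutoff `t ↦ cutoff n (T - t)`. -/
def cutoffDeriv (T : ℝ) (n : ℕ) (t : ℝ) : ℝ := deriv (fun s => cutoff n (T - s)) t

theorem contDiff_upper_cutoff (T : ℝ) (n : ℕ) : ContDiff ℝ ∞ (fun s => cutoff n (T - s)) :=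
  (contDiff_cutoff n).comp (contDiff_const.sub contDiff_id)

theorem continuous_cutoffDeriv (T : ℝ) (n : ℕ) : Continuous (cutoffDeriv T n) :=
  (contDiff_infty_iff_deriv.1 (contDiff_upper_cutoff T n)).2.continuous

theorem cutoffDeriv_eq_zero {T : ℝ} {n : ℕ} {t : ℝ} (h : 2 < n * (T - t)) :
    cutoffDeriv T n t = 0 := by
  have hc : Continuous (fun s : ℝ => (n : ℝ) * (T - s)) := by fun_prop
  have : (fun s => cutoff n (T - s)) =ᶠ[𝓝 t] fun _ => 1 := by
    filter_upwards [hc.continuousAt.eventually (lt_mem_nhds h)] with s hs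
    exact Real.smoothTransition.one_of_one_le (by linarith)
  rw [cutoffDeriv, this.deriv_eq, deriv_const]

theorem exists_bound_cutoffDeriv (T : ℝ) :
    ∃ C, 0 ≤ C ∧ ∀ n t, |cutoffDeriv T n t| ≤ C * n := by
  obtain ⟨C, hC0, hC⟩ := exists_bound_deriv_smoothTransition
  refine ⟨C, hC0, fun n t => ?_⟩
  have h1 : HasDerivAt (fun s : ℝ => (n : ℝ) * (T - s) - 1) (n * (-1)) t :=
    (((hasDerivAt_id t).const_sub T).const_mul (n : ℝ)).sub_const 1
  have h2 := ((Real.smoothTransition.contDiff (n := 1)).differentiable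
    (by simp) (n * (T - t) - 1)).hasDerivAt.comp t h1
  have h3 : cutoffDeriv T n t = deriv Real.smoothTransition (n * (T - t) - 1) * (n * (-1)) :=
    h2.deriv
  rw [h3, abs_mul, mul_neg_one, abs_neg, abs_of_nonneg (Nat.cast_nonneg n : (0 : ℝ) ≤ n)]
  exact mul_le_mul_of_nonneg_right (hC _) (Nat.cast_nonneg n)

/-- The derivative is at most `C n` and lives on the last `2 / n` of the interval, so its mass stays
below `2 C` while `q` tends to zero there. -/
theorem tendsto_integral_mul_cutoffDeriv {t₀ T : ℝ} (ht : t₀ < T) {q : ℝ → ℝ}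
    (hq : Tendsto q (𝓝[<] T) (𝓝 0)) :
    Tendsto (fun n => ∫ t in Set.Ioo t₀ T, q t * cutoffDeriv T n t) atTop (𝓝 0) := by
  obtain ⟨C, hC0, hC⟩ := exists_bound_cutoffDeriv T
  refine NormedAddGroup.tendsto_nhds_zero.2 fun e he => ?_
  -- The bound is `δ * (2 * C)`; the extra `1` makes it strictly less than `e` and covers `C = 0`.
  set δ := e / (2 * C + 1) with hδ
  have hδ0 : 0 < δ := div_pos he (by linarith)
  have hq' := (NormedAddGroup.tendsto_nhds_zero.1 hq δ hδ0)
  obtain ⟨a, ha, haq⟩ := (mem_nhdsLT_iff_exists_Ioo_subset' ht).1 hq'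
  have haT : 0 < T - max a t₀ := sub_pos.2 (max_lt ha ht)
  filter_upwards [eventually_two_lt_mul haT] with n hn
  have hn0 : (0 : ℝ) < n := by
    by_contra hneg
    have : (n : ℝ) = 0 := le_antisymm (not_lt.1 hneg) (Nat.cast_nonneg n)
    rw [this] at hn
    linarith
  have hlt : max a t₀ < T - 2 / n := by
    have : 2 / (n : ℝ) < T - max a t₀ := by
      rw [div_lt_iff₀ hn0]
      linarith
    linarith
  rw [setIntegral_eq_of_subset_of_forall_sdiff_eq_zero (s := Set.Ico (T - 2 / n) T)
    measurableSet_Ioo (fun t h => ⟨(le_max_right a t₀).trans_lt (hlt.trans_le h.1), h.2⟩)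
    fun t h => ?_]
  · have hb := norm_setIntegral_le_of_norm_le_const (μ := volume) (s := Set.Ico (T - 2 / n) T)
      (f := fun t => q t * cutoffDeriv T n t) (C := δ * (C * n)) (by simp) fun t h => by
        rw [norm_mul]
        refine mul_le_mul (haq ⟨(le_max_left a t₀).trans_lt (hlt.trans_le h.1), h.2⟩).le
          (hC n t) (norm_nonneg _) hδ0.le
    refine hb.trans_lt ?_
    rw [Real.volume_real_Ico_of_le (by linarith [div_pos two_pos hn0])]
    have : δ * (C * n) * (T - (T - 2 / n)) = δ * (2 * C) := by
      field_simp
      ring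
    rw [this, hδ, div_mul_eq_mul_div, div_lt_iff₀ (by linarith)]
    nlinarith
  · rw [cutoffDeriv_eq_zero, mul_zero]
    by_contra hneg
    refine h.2 ⟨?_, h.1.2⟩
    have : T - t ≤ 2 / n := by
      rw [le_div_iff₀ hn0]
      linarith
    linarith

theorem IsTest.terminal {Ωx : Set (Fin 3 → ℝ)} {I : Set ℝ} {φ : Pt → ℝ}
    (hφ : IsTest (Ωx ×ˢ I) φ) (T : ℝ) : IsTest Ωx (fun x => φ (x, T)) := by
  have hι : Continuous (fun x : Fin 3 → ℝ => ((x, T) : Pt)) := by fun_prop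
  have hs : tsupport (fun x => φ (x, T)) ⊆ (fun x : Fin 3 → ℝ => ((x, T) : Pt)) ⁻¹' tsupport φ :=
    tsupport_comp_subset_preimage φ hι
  refine ⟨hφ.1.comp (by fun_prop), ?_, fun x hx => (hφ.2.2 (hs hx)).1⟩
  refine HasCompactSupport.of_support_subset_isCompact (hφ.2.1.isCompact.image continuous_fst) ?_
  exact fun x hx => ⟨(x, T), hs (subset_tsupport _ hx), rfl⟩

/-- The hypothesis concerns a test function of `x` alone, so `φ(x, t)` is replaced by `φ(x, T)`. The
error is at most `L (T - t)`, which balances the factor `C n` on `T - t ≤ 2 / n`: the product stays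
bounded and is eventually zero at each point, so dominated convergence applies. -/
theorem tendsto_integral_mul_cutoffDeriv_of_slice {Ωx : Set (Fin 3 → ℝ)} (ho : IsOpen Ωx)
    {t₀ T : ℝ} (ht : t₀ < T) {F : Pt → ℝ}
    (hF : IntegrableOn F (cylinder Ωx t₀ T)) {V : Set Pt} {φ : Pt → ℝ} (hφ : IsTest V φ)
    {q : ℝ → ℝ} (hqF : ∀ᵐ t ∂(volume.restrict (Set.Ioo t₀ T)),
      q t = ∫ x in Ωx, F (x, t) * φ (x, T)) (hq : Tendsto q (𝓝[<] T) (𝓝 0)) :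
    Tendsto (fun n => ∫ y in cylinder Ωx t₀ T, F y * (φ y * cutoffDeriv T n y.2)) atTop
      (𝓝 0) := by
  have hUm := (isOpen_cylinder ho t₀ T).measurableSet
  obtain ⟨C, hC0, hC⟩ := exists_bound_cutoffDeriv T
  obtain ⟨D, hD⟩ := hφ.2.1.exists_bound_of_continuous hφ.1.continuous
  obtain ⟨L, hL⟩ := (hφ.pderiv (Fin.last 3)).2.1.exists_bound_of_continuous
    (hφ.pderiv (Fin.last 3)).1.continuous
  have hφT : Continuous (fun y : Pt => φ (y.1, T)) := hφ.1.continuous.comp (by fun_prop)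
  have hcd : ∀ n, Continuous (fun y : Pt => cutoffDeriv T n y.2) := fun n =>
    (continuous_cutoffDeriv T n).comp continuous_snd
  have hlip : ∀ x t, |φ (x, t) - φ (x, T)| ≤ L * |t - T| := fun x t =>
    convex_univ.norm_image_sub_le_of_norm_hasDerivWithin_le
      (fun s _ => (hasDerivAt_time hφ.1 x s).hasDerivWithinAt) (fun s _ => hL (x, s))
      (Set.mem_univ T) (Set.mem_univ t)
  have hL0 : 0 ≤ L := (norm_nonneg _).trans (hL 0)
  have hFT : IntegrableOn (fun y : Pt => F y * φ (y.1, T)) (cylinder Ωx t₀ T) :=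
    hF.mul_bdd (c := D) hφT.aestronglyMeasurable (ae_of_all _ fun y => hD _)
  have h1 := tendsto_setIntegral_mul_of_bounded hUm hF (C := 2 * (C * L)) (c := 0)
    (G := fun n (y : Pt) => (φ y - φ (y.1, T)) * cutoffDeriv T n y.2)
    (fun n => ((hφ.1.continuous.sub hφT).mul (hcd n)).aestronglyMeasurable)
    (fun n y hy => by
      by_cases h : 2 < n * (T - y.2)
      · rw [cutoffDeriv_eq_zero h, mul_zero, abs_zero]
        positivity
      · have hpos : 0 < T - y.2 := sub_pos.2 hy.2.2
        have hl := hlip y.1 y.2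
        rw [abs_sub_comm y.2, abs_of_pos hpos] at hl
        rw [abs_mul]
        calc _ ≤ (L * (T - y.2)) * (C * n) :=
              mul_le_mul hl (hC n y.2) (abs_nonneg _) (by positivity)
          _ = (C * L) * (n * (T - y.2)) := by ring
          _ ≤ (C * L) * 2 := mul_le_mul_of_nonneg_left (not_lt.1 h) (by positivity)
          _ = _ := by ring)
    (fun y hy => by
      refine tendsto_const_nhds.congr' ?_
      filter_upwards [eventually_two_lt_mul (sub_pos.2 hy.2.2)] with n hn
      rw [cutoffDeriv_eq_zero hn, mul_zero])
  have h2 := tendsto_integral_mul_cutoffDeriv ht hq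
  have h2' : ∀ n, ∫ t in Set.Ioo t₀ T, q t * cutoffDeriv T n t =
      ∫ y in cylinder Ωx t₀ T, (F y * φ (y.1, T)) * cutoffDeriv T n y.2 := by
    intro n
    rw [setIntegral_cylinder_mul_comp_snd hFT (continuous_cutoffDeriv T n)]
    refine integral_congr_ae ?_
    filter_upwards [hqF] with t h
    rw [h]
  have hsum := h1.add h2
  simp only [mul_zero, integral_zero, add_zero] at hsum
  refine hsum.congr fun n => ?_
  rw [h2', ← integral_add]
  · refine integral_congr_ae (ae_of_all _ fun y => ?_)
    simp only
    ring
  · have hbd : ∀ y : Pt, ‖(φ y - φ (y.1, T)) * cutoffDeriv T n y.2‖ ≤ (D + D) * (C * n) := by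
      intro y
      rw [norm_mul]
      exact mul_le_mul ((norm_sub_le _ _).trans (add_le_add (hD _) (hD _))) (hC n _)
        (norm_nonneg _) (add_nonneg ((norm_nonneg _).trans (hD y)) ((norm_nonneg _).trans (hD y)))
    exact hF.mul_bdd ((hφ.1.continuous.sub hφT).mul (hcd n)).aestronglyMeasurable
      (ae_of_all _ hbd)
  · exact hFT.mul_bdd (c := C * n) (hcd n).aestronglyMeasurable (ae_of_all _ fun y => hC n _)

/-- The interior equation must be extended to test functions that do not vanish at `T`. For
coefficients with `dt` a time cutoff costs nothing; for the others the terminal condition controls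
its derivative. -/
theorem weakEquation_of_unifiedEquation {k : ℕ} {Ωx : Set (Fin 3 → ℝ)} (ho : IsOpen Ωx)
    (hb : Bornology.IsBounded Ωx) {t₀ T : ℝ} (ht : t₀ < T) {α : Pt → ℝ} {β : Pt → Fin 3 → ℝ}
    {ε : ℝ} (hε : ε ≠ 0) {f u du : Pt → Form ℝ} {g : (Fin 3 → ℝ) → Form ℝ}
    (h : MemHD k Ωx t₀ T u du g) (hu : ∀ y ∈ cylinder Ωx t₀ T, NoDt (u y))
    (hS : L2Form (cylinder Ωx t₀ T) (scaledFlux α β ε u du))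
    (hf2 : L2Form (cylinder Ωx t₀ T) f) (hf : ∀ y ∈ cylinder Ωx t₀ T, NoDt (f y))
    (hE : UnifiedEquation (cylinder Ωx t₀ T) α β ε u du f)
    (hN : NormalTraceZero Ωx t₀ T (fun y => hodge (hodgeScaled (α y) ε (du y)))) :
    WeakEquation k Ωx t₀ T (scaledFlux α β ε u du) f g := by
  have hUb := isBounded_cylinder hb t₀ T
  have hUm := (isOpen_cylinder ho t₀ T).measurableSet
  have := Fact.mk hUb
  have hin := fun I (φ : Pt → ℝ) (hφ : IsTest (cylinder Ωx t₀ T) φ) =>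
    hE.weakCodiff_eq ho hb ht hε h hu hS hf I hφ
  intro I _ φ hφ
  by_cases hI : Fin.last 3 ∈ I
  · have hfz : ∀ φ : Pt → ℝ, ∫ y in cylinder Ωx t₀ T, f y I * φ y = 0 :=
      fun φ => setIntegral_eq_zero_of_forall_eq_zero fun y hy => by rw [hf y hy I hI, zero_mul]
    rw [if_pos hI, add_zero, hfz]
    exact weakCodiff_eq_zero_of_cylinder ho hb hS hI
      (fun φ hφ => (hin I φ hφ).trans (hfz φ))
      ⟨hφ.1, hφ.2.1, hφ.2.2.trans (Set.prod_mono_right (Set.subset_univ _))⟩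
  rw [if_neg hI]
  have hm {χ : Pt → ℝ} (hχ : Continuous χ) : MemLp χ 2 (volume.restrict (cylinder Ωx t₀ T)) :=
    memLp_restrict_of_continuous hUb hUm hχ
  have hlim {F ψ : Pt → ℝ} (hF : MemLp F 2 (volume.restrict (cylinder Ωx t₀ T)))
      (hψ : Continuous ψ) :
      Tendsto (fun n => ∫ y in cylinder Ωx t₀ T, F y * (ψ y * cutoff n (T - y.2))) atTop
        (𝓝 (∫ y in cylinder Ωx t₀ T, F y * ψ y)) := by
    have := tendsto_setIntegral_mul_of_bounded (μ := volume) hUm (C := 1) (c := 1)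
      (integrable_mul_of_memLp hF (hm hψ)) (G := fun n y => cutoff n (T - y.2))
      (fun n => ((contDiff_upper_cutoff T n).continuous.comp
        continuous_snd).aestronglyMeasurable)
      (fun n y _ => abs_cutoff_le _ _) (fun y hy => tendsto_cutoff (sub_pos.2 hy.2.2))
    simpa only [mul_assoc, mul_one] using this
  obtain ⟨q, hqF, hq⟩ := (normalTraceZero_iff hε).1 hN I hI _ (hφ.terminal T)
  have hdq := tendsto_integral_mul_cutoffDeriv_of_slice ho ht
    ((h.deriv_memL2 (insert (Fin.last 3) I)).integrable (by simp)) hφ hqF hq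
  have hΘ : ∀ n, ContDiff ℝ ∞ (fun y : Pt => cutoff n (T - y.2)) := fun n =>
    (contDiff_upper_cutoff T n).comp contDiff_snd
  have hpt : ∀ n y, pderiv (Fin.last 3) (fun z => φ z * cutoff n (T - z.2)) y =
      φ y * cutoffDeriv T n y.2 + pderiv (Fin.last 3) φ y * cutoff n (T - y.2) := by
    intro n y
    rw [pderiv_mul hφ.1 (hΘ n), pderiv_last_comp_snd _ (contDiff_upper_cutoff T n)]
    rfl
  have hpx : ∀ i ∈ (insert (Fin.last 3) I)ᶜ, ∀ n y,
      pderiv i (fun z => φ z * cutoff n (T - z.2)) y = pderiv i φ y * cutoff n (T - y.2) := by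
    intro i hi n y
    have hne : i ≠ Fin.last 3 := fun e =>
      Finset.mem_compl.1 hi (e ▸ Finset.mem_insert_self _ _)
    rw [pderiv_mul hφ.1 (hΘ n),
      pderiv_castSucc_comp_snd _ (contDiff_upper_cutoff T n) hne, mul_zero, zero_add]
  -- The interior equation for the truncated function, with Green's formula already applied: `u`
  -- itself is never paired with the derivative of the cutoff, which meets only the `dt` part of `d
  -- u`.
  have heq : ∀ n,
      (∑ i ∈ (insert (Fin.last 3) I)ᶜ, (sgn {i} I : ℝ) * ∫ y in cylinder Ωx t₀ T,
        scaledFlux α β ε u du y (insert i I) * (pderiv i φ y * cutoff n (T - y.2))) +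
      ((-1) ^ I.card * (ε * ((∫ y in cylinder Ωx t₀ T,
          du y (insert (Fin.last 3) I) * (φ y * cutoffDeriv T n y.2)) +
        ∫ y in cylinder Ωx t₀ T, du y (insert (Fin.last 3) I) *
          (pderiv (Fin.last 3) φ y * cutoff n (T - y.2)))) +
      (-1) ^ I.card * ∫ y in cylinder Ωx t₀ T,
        du y (insert (Fin.last 3) I) * (φ y * cutoff n (T - y.2))) =
      ∫ y in cylinder Ωx t₀ T, f y I * (φ y * cutoff n (T - y.2)) := by
    intro n
    have hφn : IsTest (cylinder Ωx t₀ T) (fun y => φ y * cutoff n (T - y.2)) := by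
      have := hφ.mul_upper_cutoff (T := T) n
      rwa [Set.Ioi_inter_Iio] at this
    have h1 := hin I _ hφn
    have h2 := h.integral_time_deriv_mul ho hb ht hu hI hφn.1
    have hz : ∀ x, φ (x, T) * cutoff n (T - T) = 0 := fun x =>
      image_eq_zero_of_notMem_tsupport (f := fun y : Pt => φ y * cutoff n (T - y.2))
        (x := (x, T)) fun hx => lt_irrefl T (hφn.2.2 hx).2.2
    simp only [hz, mul_zero, integral_zero, zero_sub] at h2
    have hsum : ∑ i ∈ (insert (Fin.last 3) I)ᶜ, (sgn {i} I : ℝ) * ∫ y in cylinder Ωx t₀ T,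
          scaledFlux α β ε u du y (insert i I) *
            pderiv i (fun z => φ z * cutoff n (T - z.2)) y =
        ∑ i ∈ (insert (Fin.last 3) I)ᶜ, (sgn {i} I : ℝ) * ∫ y in cylinder Ωx t₀ T,
          scaledFlux α β ε u du y (insert i I) * (pderiv i φ y * cutoff n (T - y.2)) :=
      Finset.sum_congr rfl fun i hi => by simp only [hpx i hi n]
    rw [weakCodiff_split ho hb hε h hu hI hφn.1, hsum] at h1
    have hI1 : ∫ y in cylinder Ωx t₀ T, du y (insert (Fin.last 3) I) *
          pderiv (Fin.last 3) (fun z => φ z * cutoff n (T - z.2)) y =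
        (∫ y in cylinder Ωx t₀ T,
          du y (insert (Fin.last 3) I) * (φ y * cutoffDeriv T n y.2)) +
        ∫ y in cylinder Ωx t₀ T, du y (insert (Fin.last 3) I) *
          (pderiv (Fin.last 3) φ y * cutoff n (T - y.2)) := by
      simp only [hpt, mul_add]
      refine integral_add (integrable_mul_of_memLp (h.deriv_memL2 _) (hm ?_))
        (integrable_mul_of_memLp (h.deriv_memL2 _) (hm ?_))
      · exact hφ.1.continuous.mul ((continuous_cutoffDeriv T n).comp continuous_snd)
      · exact (contDiff_pderiv hφ.1 _).continuous.mul (hΘ n).continuous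
    rw [hI1] at h1
    linarith
  -- The `0` is the limit of the cutoff-derivative term, supplied by the terminal condition.
  have hL : Tendsto _ atTop (𝓝 (
      (∑ i ∈ (insert (Fin.last 3) I)ᶜ, (sgn {i} I : ℝ) * ∫ y in cylinder Ωx t₀ T,
        scaledFlux α β ε u du y (insert i I) * pderiv i φ y) +
      ((-1) ^ I.card * (ε * (0 + ∫ y in cylinder Ωx t₀ T,
        du y (insert (Fin.last 3) I) * pderiv (Fin.last 3) φ y)) +
      (-1) ^ I.card * ∫ y in cylinder Ωx t₀ T, du y (insert (Fin.last 3) I) * φ y))) :=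
    (tendsto_finsetSum _ fun i _ =>
      (hlim (hS (insert i I)) (contDiff_pderiv hφ.1 i).continuous).const_mul _).add
    (((hdq.add (hlim (h.deriv_memL2 _)
      (contDiff_pderiv hφ.1 (Fin.last 3)).continuous)).const_mul ε |>.const_mul _).add
      ((hlim (h.deriv_memL2 _) hφ.1.continuous).const_mul _))
  have hR := hlim (hf2 I) hφ.1.continuous
  simp only [heq] at hL
  have hfin := tendsto_nhds_unique hL hR
  -- Green's formula for the untruncated function brings back the trace at `T`.
  have hg := h.integral_time_deriv_mul ho hb ht hu hI hφ.1
  rw [weakCodiff_split ho hb hε h hu hI hφ.1]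
  linarith

end SpaceTime

end

/-! ### The equivalence -/

theorem mainTheorem4
    (k : ℕ) (hk : k ≤ 4)
    (Ωx : Set (Fin 3 → ℝ)) (hΩx : IsOpen Ωx) (hΩb : Bornology.IsBounded Ωx)
    (t₀ T : ℝ) (ht : t₀ < T)
    (ε : ℝ) (hε : 0 < ε)
    (α : SpaceTime.Pt → ℝ) (hα : Measurable α)
    (hαb : ∃ α₀ α₁ : ℝ, 0 < α₀ ∧ ∀ y ∈ SpaceTime.cylinder Ωx t₀ T, α₀ ≤ α y ∧ α y ≤ α₁)
    (β : SpaceTime.Pt → Fin 3 → ℝ) (hβ : Measurable β)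
    (hβb : ∃ M : ℝ, ∀ y ∈ SpaceTime.cylinder Ωx t₀ T, ∀ i, |β y i| ≤ M)
    (f : SpaceTime.Pt → SpaceTime.Form ℝ)
    (hf : SpaceTime.L2Form (SpaceTime.cylinder Ωx t₀ T) f)
    (hf' : ∀ y ∈ SpaceTime.cylinder Ωx t₀ T, SpaceTime.IsForm k (f y) ∧ SpaceTime.NoDt (f y))
    (u : SpaceTime.Pt → SpaceTime.Form ℝ)
    (hu : ∀ y ∈ SpaceTime.cylinder Ωx t₀ T, SpaceTime.IsForm k (u y) ∧ SpaceTime.NoDt (u y)) :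
    SpaceTime.IsUnifiedSolution k Ωx t₀ T α β ε f u ↔
      SpaceTime.IsVariationalSolution k Ωx t₀ T α β ε f u := by
  have hUm := (SpaceTime.isOpen_cylinder hΩx t₀ T).measurableSet
  have hu' := fun y hy => (hu y hy).2
  have hS : ∀ du g, SpaceTime.MemHD k Ωx t₀ T u du g →
      SpaceTime.L2Form (SpaceTime.cylinder Ωx t₀ T) (SpaceTime.scaledFlux α β ε u du) :=
    fun du g h => SpaceTime.scaledFlux_memL2 hUm hα hαb hβ hβb ε h.memL2 h.deriv_memL2
  constructor
  · rintro ⟨du, g, h, hE, hN⟩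
    refine ⟨du, g, h, ?_⟩
    rw [SpaceTime.forall_bilin_eq_iff_weakEquation hΩx hΩb (hS du g h) hf h.trace_memL2]
    exact SpaceTime.weakEquation_of_unifiedEquation hΩx hΩb ht hε.ne' h hu' (hS du g h) hf
      (fun y hy => (hf' y hy).2) hE hN
  · rintro ⟨du, g, h, hv⟩
    rw [SpaceTime.forall_bilin_eq_iff_weakEquation hΩx hΩb (hS du g h) hf h.trace_memL2] at hv
    exact ⟨du, g, h, SpaceTime.unifiedEquation_and_normalTraceZero hΩx hΩb ht hε.ne' h hu
      (hS du g h) hf hf' hv⟩
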